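/- Conventions. An abstract elementary class (AEC) is a pair $\mathcal K=(K,\le_{\mathcal K})$, where $K$ is a class of structures (empty structures are allowed) in a fixed finitary vocabulary $\tau=\tau(\mathcal K)$, $\le_{\mathcal K}$ is a partial order on $K$ such that $M\le_{\mathcal K}N$ implies $M\subseteq N$, both are closed under isomorphisms, and: (i) if $M_0\subseteq M_1\le_{\mathcal K}M_2$ and $M_0\le_{\mathcal K}M_2$, with all $M_i\in K$, then $M_0\le_{\mathcal K}M_1$; (ii) if $\delta$ is a limit ordinal, $\langle M_i:i<\delta\rangle$ is a $\le_{\mathcal K}$-increasing chain and $M=\bigcup_{i<\delta}M_i$, then $M\in K$, $M_0\le_{\mathcal K}M$, and $M\le_{\mathcal K}N$ for every $N\in K$ such that $M_i\le_{\mathcal K}N$ for all $i<\delta$; (iii) there is a cardinal $\lambda\ge|\tau|+\aleph_0$ such that for all $N\in K$ and $A\subseteq|N|$ there is $M\le_{\mathcal K}N$ with $A\subseteq|M|$ and $\|M\|\le|A|+\lambda$; the least such $\lambda$ is $\operatorname{LS}(\mathcal K)$. $\mathcal K$ has intersections if for all $N\in K$ and $A\subseteq|N|$ the substructure of $N$ with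 universe $\bigcap\{|N_0| : N_0\le_{\mathcal K}N,\ A\subseteq|N_0|\}$ is $\le_{\mathcal K}N$. A functorial expansion of $\mathcal K$ is an AEC $\mathcal K^+=(K^+,\le_{\mathcal K^+})$ in a finitary vocabulary $\tau^+\supseteq\tau$ such that the reduct map $M^+\mapsto M^+\upharpoonright\tau$ is a bijection from $K^+$ onto $K$, every isomorphism between members of $K$ is an isomorphism between their expansions in $K^+$, $M\le_{\mathcal K}N$ implies that the expansion of $M$ is a substructure of the expansion of $N$, and, for $M^+,N^+\in K^+$, $M^+\le_{\mathcal K^+}N^+$ if and only if $M^+\upharpoonright\tau\le_{\mathcal K}N^+\upharpoonright\tau$. "Countable" means finite or countably infinite. For countable $\tau$, a $\tau$-structure with universe a subset of $\mathbb N$ is coded by its atomic diagram, a point of the Cantor space $2^{I}$, where $I$ is the countable set of atomic statements "$k$ is in the universe", "$R(a_1,\dots,a_n)$", "$f(a_1,\dots,a_n)=m$" with $R,f\in\tau$ and $k,m,a_i\in\mathbb N$. An AEC $\mathcal K$ is Borel presented (respectively analytically presented) if $\operatorname{LS}(\mathcal K)=\aleph_0$ and both the set of codes of members of $K$ with universe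 a subset of $\mathbb N$, and the set of pairs of codes of such $M,N$ with $M\le_{\mathcal K}N$, are Borel (respectively analytic). Statement. Let $\mathcal K$ be an AEC with intersections such that $\operatorname{LS}(\mathcal K)=\aleph_0$ and $\mathcal K$ has, up to isomorphism, at most countably many countable (finite or countably infinite) members. Then $\mathcal K$ has a functorial expansion $\mathcal K^+$ that is Borel presented. Moreover $\mathcal K$ is analytically presented. -/

import Mathlib

open FirstOrder Cardinal MeasureTheory

universe u

/-- An abstract elementary class in the vocabulary `L`.

`Mem M` says that the `L`-structure `M` belongs to the class `K`.  For a substructure `S` of an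
`L`-structure `N`, `Strong S` is the relation "`S ≤_K N`".  Since `M ≤_K N` implies `M ⊆ N`, the
ordering of the class is a relation between structures and their substructures. -/
structure AEC (L : FirstOrder.Language.{u, u}) where
  /-- membership in the class -/
  Mem : ∀ (M : Type u) [L.Structure M], Prop
  /-- the ordering of the class: `Strong S` for `S ⊆ N` means `S ≤_K N` -/
  Strong : ∀ {N : Type u} [L.Structure N], L.Substructure N → Prop
  /-- `K` is closed under isomorphisms -/
  mem_iso : ∀ {M N : Type u} [L.Structure M] [L.Structure N], Nonempty (M ≃[L] N) →
    Mem M → Mem N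
  /-- `≤_K` is closed under isomorphisms -/
  strong_iso : ∀ {M N : Type u} [L.Structure M] [L.Structure N] (e : M ≃[L] N)
    (S : L.Substructure M), Strong S → Strong (S.map e.toHom)
  /-- `≤_K` is a relation between members of `K` -/
  mem_of_strong : ∀ {N : Type u} [L.Structure N] (S : L.Substructure N), Strong S →
    Mem S ∧ Mem N
  /-- reflexivity -/
  strong_refl : ∀ (N : Type u) [L.Structure N], Mem N → Strong (⊤ : L.Substructure N)
  /-- transitivity: `S ≤_K T ≤_K N` implies `S ≤_K N` -/
  strong_trans : ∀ {N : Type u} [L.Structure N] (S T : L.Substructure N), S ≤ T →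
    Strong (S.comap T.subtype.toHom) → Strong T → Strong S
  /-- coherence: `S ⊆ T ≤_K N` and `S ≤_K N` imply `S ≤_K T` -/
  coherence : ∀ {N : Type u} [L.Structure N] (S T : L.Substructure N), S ≤ T →
    Strong S → Strong T → Strong (S.comap T.subtype.toHom)
  /-- unions of chains: if `M` is the union of a `≤_K`-increasing chain `(S i)_{i < δ}`, `δ` a
  limit ordinal, then `M ∈ K` and `S 0 ≤_K M` -/
  chain : ∀ {M : Type u} [L.Structure M] (δ : Ordinal.{u}) (S : Ordinal.{u} → L.Substructure M),
    Order.IsSuccLimit δ → (∀ i < δ, Mem (S i)) →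
    (∀ i j, i ≤ j → j < δ → S i ≤ S j ∧ Strong ((S i).comap (S j).subtype.toHom)) →
    (∀ x : M, ∃ i < δ, x ∈ S i) → Mem M ∧ Strong (S 0)
  /-- smoothness: if the members of a `≤_K`-increasing chain are all `≤_K N`, so is its union -/
  smooth : ∀ {N : Type u} [L.Structure N] (δ : Ordinal.{u}) (S : Ordinal.{u} → L.Substructure N)
    (T : L.Substructure N), Order.IsSuccLimit δ → Mem N →
    (∀ i j, i ≤ j → j < δ → S i ≤ S j ∧ Strong ((S i).comap (S j).subtype.toHom)) →
    (∀ i < δ, Strong (S i)) → (∀ x : N, x ∈ T ↔ ∃ i < δ, x ∈ S i) → Strong T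
  /-- the Löwenheim-Skolem-Tarski axiom -/
  lowenheim_skolem : ∃ κ : Cardinal.{u}, L.card + ℵ₀ ≤ κ ∧
    ∀ (N : Type u) [L.Structure N], Mem N → ∀ A : Set N,
      ∃ S : L.Substructure N, A ⊆ S ∧ Strong S ∧ #S ≤ #A + κ

namespace AEC

variable {L L' : FirstOrder.Language.{u, u}}

/-- The Löwenheim-Skolem-Tarski number `LS(K)`. -/
noncomputable def LS (K : AEC L) : Cardinal.{u} :=
  sInf {κ : Cardinal.{u} | L.card + ℵ₀ ≤ κ ∧
    ∀ (N : Type u) [L.Structure N], K.Mem N → ∀ A : Set N,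
      ∃ S : L.Substructure N, A ⊆ S ∧ K.Strong S ∧ #S ≤ #A + κ}

/-- `cl^N(A)`: the intersection of all `S ≤_K N` that contain `A`. -/
def cl (K : AEC L) {N : Type u} [L.Structure N] (A : Set N) : L.Substructure N :=
  sInf {S : L.Substructure N | K.Strong S ∧ A ⊆ S}

/-- `K` has intersections. -/
def HasIntersections (K : AEC L) : Prop :=
  ∀ (N : Type u) [L.Structure N], K.Mem N → ∀ A : Set N, K.Strong (K.cl A)

/-- The set of isomorphism types of the countable (finite or countably infinite) members of `K`. -/
def countableModels (K : AEC L) : Set (Quotient (FirstOrder.Language.equivSetoid (L := L))) :=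
  Quotient.mk _ '' {M : CategoryTheory.Bundled.{u} L.Structure | Countable M ∧ K.Mem M}

/-- `K'` is a functorial expansion of `K`, its vocabulary `L'` being an expansion of `L` along
`φ`.  An `L'`-structure on `M` has the given `L`-structure of `M` as its reduct if and only if
`φ.IsExpansionOn M`. -/
structure IsFunctorialExpansion (K : AEC L) (φ : L →ᴸ L') (K' : AEC L') : Prop where
  /-- `L'` extends `L` -/
  injective : φ.Injective
  /-- the reduct of a member of `K'` is in `K` -/
  reduct_mem : ∀ (M : Type u) [L.Structure M] [L'.Structure M] [φ.IsExpansionOn M],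
    K'.Mem M → K.Mem M
  /-- taking reducts is a bijection from `K'` onto `K` -/
  existsUnique : ∀ (M : Type u) [L.Structure M], K.Mem M →
    ∃! s : L'.Structure M, @FirstOrder.Language.LHom.IsExpansionOn L L' φ M _ s ∧ @AEC.Mem L' K' M s
  /-- isomorphisms between members of `K` are isomorphisms between their expansions -/
  iso : ∀ (M N : Type u) [L.Structure M] [L'.Structure M] [φ.IsExpansionOn M]
    [L.Structure N] [L'.Structure N] [φ.IsExpansionOn N], K'.Mem M → K'.Mem N →
    ∀ f : M ≃[L] N, ∃ g : M ≃[L'] N, ∀ x, g x = f x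
  /-- if `S ≤_K N`, then the expansion of `S` is a substructure of the expansion of `N` -/
  mono : ∀ (N : Type u) [L.Structure N] [L'.Structure N] [φ.IsExpansionOn N], K'.Mem N →
    ∀ S : L.Substructure N, K.Strong S →
      ∃ S' : L'.Substructure N, (S' : Set N) = S ∧ K'.Mem S'
  /-- the ordering of `K'` is the one induced by the ordering of `K` -/
  strong_iff : ∀ (N : Type u) [L.Structure N] [L'.Structure N] [φ.IsExpansionOn N]
    (S : L'.Substructure N),
    K'.Strong S ↔ K'.Mem S ∧ K'.Mem N ∧ K.Strong (φ.substructureReduct S)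

end AEC

/-- The atomic statements about an `L`-structure whose universe is a subset of `ℕ`:
"`k` is in the universe", "`R(a₁, …, aₙ)` holds" and "`f(a₁, …, aₙ)` is defined and equals `m`". -/
abbrev AtomicFact (L : FirstOrder.Language.{u, u}) : Type u :=
  ℕ ⊕ (Σ n, L.Relations n × (Fin n → ℕ)) ⊕ (Σ n, L.Functions n × (Fin n → ℕ) × ℕ)

/-- The space of codes for `L`-structures with universe a subset of `ℕ`, with the product topology.
For countable `L` this is (a copy of) the Cantor space. -/
abbrev StructureCode (L : FirstOrder.Language.{u, u}) : Type u := AtomicFact L → Bool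

open Classical in
/-- The code (atomic diagram) of the copy of `M` along the injection `g : M → ℕ`; this copy has
universe `range g ⊆ ℕ`. -/
noncomputable def structureCode {L : FirstOrder.Language.{u, u}} {M : Type u} [L.Structure M] (g : M ↪ ℕ) :
    StructureCode L
  | Sum.inl k => decide (k ∈ Set.range g)
  | Sum.inr (Sum.inl ⟨n, R, a⟩) =>
      decide (∃ b : Fin n → M, (∀ i, g (b i) = a i) ∧ FirstOrder.Language.Structure.RelMap R b)
  | Sum.inr (Sum.inr ⟨n, f, a, m⟩) =>
      decide (∃ b : Fin n → M, (∀ i, g (b i) = a i) ∧ g (FirstOrder.Language.Structure.funMap f b) = m)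

namespace AEC

variable {L : FirstOrder.Language.{u, u}}

/-- The set of codes of the members of `K` with universe a subset of `ℕ`. -/
def codes (K : AEC L) : Set (StructureCode L) :=
  {c | ∃ (M : Type u) (_ : L.Structure M) (g : M ↪ ℕ), K.Mem M ∧ c = structureCode g}

/-- The set of pairs of codes of structures `M ≤_K N` whose universes are subsets of `ℕ`. -/
def strongCodes (K : AEC L) : Set (StructureCode L × StructureCode L) :=
  {p | ∃ (N : Type u) (_ : L.Structure N) (g : N ↪ ℕ) (S : L.Substructure N), K.Strong S ∧
    p = (structureCode (S.subtype.toEmbedding.trans g), structureCode g)}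

/-- `K` is Borel presented: `LS(K) = ℵ₀`, and the class of countable members of `K` and the
ordering on it are Borel. -/
def BorelPresented (K : AEC L) : Prop :=
  K.LS = ℵ₀ ∧ MeasurableSet[borel _] K.codes ∧ MeasurableSet[borel _] K.strongCodes

/-- `K` is analytically presented: `LS(K) = ℵ₀`, and the class of countable members of `K` and
the ordering on it are analytic. -/
def AnalyticallyPresented (K : AEC L) : Prop :=
  K.LS = ℵ₀ ∧ MeasureTheory.AnalyticSet K.codes ∧ MeasureTheory.AnalyticSet K.strongCodes

end AEC

/-!
The expansion adds, for each isomorphism type of pairs `(M, t)` where `M` is a countable member of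
`K` and `t` a finite tuple with `cl(t) = M`, a predicate that holds at a tuple `a` of `N` when
`(cl(a), a)` has this type (`AEC.ClosureType`, `AEC.ClosureType.Realize`).  As `LS(K) = ℵ₀` and `K`
has countably many countable members up to isomorphism, there are countably many such predicates,
and every tuple satisfies one of them.  Closures are computed in the same way in a structure and in
its `≤_K`-extensions (`AEC.cl_image`), so the predicates are invariant under isomorphisms and
preserved by `≤_K`, and the canonical expansions form an AEC, `AEC.expandedAEC`.

In the expanded vocabulary it is Borel to be a canonical expansion, although being isomorphic to a
given countable structure is in general merely an analytic condition on a code.  The reason is that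
all types of closures have names, so that countably many axioms about finite tuples
(`AEC.ClosureAxioms`) support a back-and-forth construction: in a countable model of the axioms the
closure of each tuple, as described by the predicates, is a copy of one of the representatives
(`AEC.ClosureAxioms.exists_embedding`).  The model is then the union of an `ω`-chain of closures of
finite tuples, which puts it in `K` with the intended closures
(`AEC.ClosureAxioms.mem_and_isCanonical`).  The ordering is Borel because a countable `S ⊆ N` is
`≤_K N` if and only if it contains the closure in `N` of each of its finite tuples, again by an
`ω`-chain (`AEC.strong_of_cl_le`), and membership in a closure is expressed by the predicates.

Codes for `K` are obtained from those for the expansion by the continuous map that forgets the new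
predicates, so they form analytic sets.
-/

namespace AEC

open FirstOrder.Language Set

variable {L : FirstOrder.Language.{u, u}} (K : AEC L)

/-! ### Strong embeddings -/

section StrongEmbeddings

variable {M N P : Type u} [L.Structure M] [L.Structure N] [L.Structure P]

/-- A `K`-embedding: an embedding of `M` into `N` whose range is `≤_K N`. -/
def StrongEmb (f : M ↪[L] N) : Prop :=
  K.Strong f.toHom.range

variable {K}

theorem strong_comap_map_iff (g : N ↪[L] P) (A : L.Substructure N) :
    K.Strong ((A.map g.toHom).comap g.toHom.range.subtype.toHom) ↔ K.Strong A := by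
  have h1 : (A.map g.toHom).comap g.toHom.range.subtype.toHom = A.map g.equivRange.toHom := by
    ext ⟨x, hx⟩
    simp only [Substructure.mem_comap, Substructure.mem_map]
    constructor
    · rintro ⟨y, hy, h⟩
      exact ⟨y, hy, Subtype.ext h⟩
    · rintro ⟨y, hy, h⟩
      exact ⟨y, hy, congrArg Subtype.val h⟩
  have h2 : (A.map g.equivRange.toHom).map g.equivRange.symm.toHom = A := by
    ext x
    simp only [Substructure.mem_map]
    constructor
    · rintro ⟨_, ⟨y, hy, rfl⟩, rfl⟩
      have : g.equivRange.symm.toHom (g.equivRange.toHom y) = y :=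
        g.equivRange.symm_apply_apply y
      rwa [this]
    · intro hx
      exact ⟨_, ⟨x, hx, rfl⟩, g.equivRange.symm_apply_apply x⟩
  rw [h1]
  refine ⟨fun h => ?_, K.strong_iso _ _⟩
  simpa only [h2] using K.strong_iso g.equivRange.symm _ h

theorem strong_map_iff {g : N ↪[L] P} (hg : K.StrongEmb g) (A : L.Substructure N) :
    K.Strong (A.map g.toHom) ↔ K.Strong A := by
  have hle : A.map g.toHom ≤ g.toHom.range := Hom.map_le_range
  rw [← strong_comap_map_iff g A]
  exact ⟨fun h => K.coherence _ _ hle h hg, fun h => K.strong_trans _ _ hle h hg⟩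

theorem strongEmb_subtype {S : L.Substructure N} : K.StrongEmb S.subtype ↔ K.Strong S := by
  rw [StrongEmb, Substructure.range_subtype]

theorem StrongEmb.mem_left {f : M ↪[L] N} (hf : K.StrongEmb f) : K.Mem M :=
  K.mem_iso ⟨f.equivRange.symm⟩ (K.mem_of_strong _ hf).1

theorem StrongEmb.mem_right {f : M ↪[L] N} (hf : K.StrongEmb f) : K.Mem N :=
  (K.mem_of_strong _ hf).2

theorem strongEmb_comp_iff {g : N ↪[L] P} (hg : K.StrongEmb g) (f : M ↪[L] N) :
    K.StrongEmb (g.comp f) ↔ K.StrongEmb f := by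
  rw [StrongEmb, StrongEmb, ← strong_map_iff hg f.toHom.range]
  have : (g.comp f).toHom.range = f.toHom.range.map g.toHom := by
    ext x
    simp [Hom.mem_range, Substructure.mem_map]
  rw [this]

theorem strongEmb_of_surjective (f : M ↪[L] N) (hN : K.Mem N) (hf : Function.Surjective f) :
    K.StrongEmb f := by
  have : f.toHom.range = ⊤ := Hom.range_eq_top.2 hf
  rw [StrongEmb, this]
  exact K.strong_refl N hN

theorem strongEmb_equiv (e : M ≃[L] N) (hN : K.Mem N) : K.StrongEmb e.toEmbedding :=
  strongEmb_of_surjective _ hN e.surjective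

/-- An embedding whose range lies in the range of the embedding `g` factors through `g`. -/
theorem exists_factor (g : N ↪[L] P) (f : M ↪[L] P) (h : range f ⊆ range g) :
    ∃ k : M ↪[L] N, g.comp k = f := by
  have h' : ∀ x, f x ∈ g.toHom.range := fun x => h (mem_range_self x)
  refine ⟨g.equivRange.symm.toEmbedding.comp (Embedding.codRestrict _ f h'), ?_⟩
  ext x
  have := congrArg Subtype.val (g.equivRange.apply_symm_apply (Embedding.codRestrict _ f h' x))
  rwa [Embedding.equivRange_apply, Embedding.codRestrict_apply] at this

theorem mem_map_iff_of_embedding (g : N ↪[L] P) (A : L.Substructure N) (x : N) :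
    g x ∈ A.map g.toHom ↔ x ∈ A := by
  constructor
  · rintro ⟨y, hy, h⟩
    exact g.injective h ▸ hy
  · exact fun h => ⟨x, h, rfl⟩

/-! ### Closures -/

theorem subset_cl (A : Set N) : A ⊆ K.cl A := by
  intro x hx
  exact Substructure.mem_sInf.2 fun S hS => hS.2 hx

theorem cl_le {S : L.Substructure N} (hS : K.Strong S) {A : Set N} (h : A ⊆ S) : K.cl A ≤ S :=
  sInf_le ⟨hS, h⟩

theorem cl_mono {A B : Set N} (h : A ⊆ B) : K.cl A ≤ K.cl B :=
  sInf_le_sInf fun _ hS => ⟨hS.1, h.trans hS.2⟩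

/-- Closures are absolute: they are computed in the same way in `N` and in a `≤_K`-extension. -/
theorem cl_image (hint : K.HasIntersections) {g : N ↪[L] P} (hg : K.StrongEmb g) (A : Set N) :
    K.cl (g '' A) = (K.cl A).map g.toHom := by
  have hN := hg.mem_left
  have hP := hg.mem_right
  apply le_antisymm
  · refine cl_le ((strong_map_iff hg _).2 (hint N hN A)) ?_
    rintro _ ⟨x, hx, rfl⟩
    exact ⟨x, subset_cl A hx, rfl⟩
  · have h1 : K.cl (g '' A) ≤ g.toHom.range := by
      refine cl_le hg ?_
      rintro _ ⟨x, -, rfl⟩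
      exact ⟨x, rfl⟩
    have h2 : ((K.cl (g '' A)).comap g.toHom).map g.toHom = K.cl (g '' A) := by
      ext x
      constructor
      · rintro ⟨y, hy, rfl⟩
        exact hy
      · intro hx
        obtain ⟨y, rfl⟩ := h1 hx
        exact ⟨y, hx, rfl⟩
    rw [← h2]
    refine Substructure.monotone_map (cl_le ((strong_map_iff hg _).1 ?_) ?_)
    · rw [h2]
      exact hint P hP _
    · intro x hx
      exact subset_cl _ ⟨x, hx, rfl⟩

theorem mem_cl_image_iff (hint : K.HasIntersections) {g : N ↪[L] P} (hg : K.StrongEmb g)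
    (A : Set N) (x : N) : g x ∈ K.cl (g '' A) ↔ x ∈ K.cl A := by
  rw [cl_image hint hg, mem_map_iff_of_embedding]

end StrongEmbeddings

/-! ### Löwenheim–Skolem number `ℵ₀` -/

section LowenheimSkolem

variable {K}

/-- The infimum `LS(K)` is attained. -/
theorem LS_spec (K : AEC L) : L.card + ℵ₀ ≤ K.LS ∧
    ∀ (N : Type u) [L.Structure N], K.Mem N → ∀ A : Set N,
      ∃ S : L.Substructure N, A ⊆ S ∧ K.Strong S ∧ #S ≤ #A + K.LS :=
  csInf_mem (s := {κ : Cardinal.{u} | L.card + ℵ₀ ≤ κ ∧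
    ∀ (N : Type u) [L.Structure N], K.Mem N → ∀ A : Set N,
      ∃ S : L.Substructure N, A ⊆ S ∧ K.Strong S ∧ #S ≤ #A + κ}) K.lowenheim_skolem

theorem card_le_aleph0 (hLS : K.LS = ℵ₀) : L.card ≤ ℵ₀ :=
  (self_le_add_right _ _).trans ((LS_spec K).1.trans hLS.le)

theorem countable_symbols (hL : L.card ≤ ℵ₀) :
    (∀ n, Countable (L.Relations n)) ∧ ∀ n, Countable (L.Functions n) := by
  have : Countable L.Symbols := mk_le_aleph0_iff.1 hL
  refine ⟨fun n => ?_, fun n => ?_⟩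
  · exact Function.Injective.countable (f := fun r : L.Relations n => (Sum.inr ⟨n, r⟩ : L.Symbols))
      fun r r' h => by simpa using h
  · exact Function.Injective.countable (f := fun r : L.Functions n => (Sum.inl ⟨n, r⟩ : L.Symbols))
      fun r r' h => by simpa using h

theorem LS_eq_aleph0 {K : AEC L} (hL : L.card ≤ ℵ₀)
    (h : ∀ (N : Type u) [L.Structure N], K.Mem N → ∀ A : Set N,
      ∃ S : L.Substructure N, A ⊆ S ∧ K.Strong S ∧ #S ≤ #A + ℵ₀) : K.LS = ℵ₀ := by
  refine le_antisymm (csInf_le' ⟨?_, h⟩) ((self_le_add_left _ _).trans (LS_spec K).1)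
  simpa using hL

theorem countable_cl (hLS : K.LS = ℵ₀) {N : Type u} [L.Structure N] (hN : K.Mem N) {A : Set N}
    (hA : A.Countable) : Countable (K.cl A) := by
  obtain ⟨S, hAS, hS, hc⟩ := (LS_spec K).2 N hN A
  have h1 : #S ≤ ℵ₀ := by
    refine hc.trans ?_
    rw [hLS]
    simpa using hA
  have : Countable S := mk_le_aleph0_iff.1 h1
  exact (Set.countable_coe_iff.1 this).mono (cl_le hS hAS) |>.to_subtype

end LowenheimSkolem

/-! ### Chains of order type `ω` -/

section Chains

variable {K} {N : Type u} [L.Structure N]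

/-- A sequence indexed by `ℕ`, reindexed by ordinals. -/
noncomputable def ordinalSeq {α : Type*} (S : ℕ → α) (o : Ordinal.{u}) : α :=
  S (Cardinal.toNat o.card)

theorem ordinalSeq_natCast {α : Type*} (S : ℕ → α) (n : ℕ) :
    ordinalSeq S (n : Ordinal.{u}) = S n := by
  simp [ordinalSeq]

theorem ordinalSeq_chain {S : ℕ → L.Substructure N}
    (h : ∀ m n, m ≤ n → S m ≤ S n ∧ K.Strong ((S m).comap (S n).subtype.toHom))
    (i j : Ordinal.{u}) (hij : i ≤ j) (hj : j < Ordinal.omega0) :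
    ordinalSeq S i ≤ ordinalSeq S j ∧
      K.Strong ((ordinalSeq S i).comap (ordinalSeq S j).subtype.toHom) := by
  obtain ⟨n, rfl⟩ := Ordinal.lt_omega0.1 hj
  obtain ⟨m, rfl⟩ := Ordinal.lt_omega0.1 (hij.trans_lt hj)
  rw [ordinalSeq_natCast, ordinalSeq_natCast]
  exact h m n (by exact_mod_cast hij)

theorem mem_ordinalSeq_iff {S : ℕ → L.Substructure N} (x : N) :
    (∃ i < (Ordinal.omega0 : Ordinal.{u}), x ∈ ordinalSeq S i) ↔ ∃ n, x ∈ S n := by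
  constructor
  · rintro ⟨i, -, hx⟩
    exact ⟨_, hx⟩
  · rintro ⟨n, hx⟩
    exact ⟨n, Ordinal.natCast_lt_omega0 n, by rwa [ordinalSeq_natCast]⟩

/-- The union of an `ω`-chain is in `K`, and every member of the chain is strong in it. -/
theorem mem_of_nat_chain {S : ℕ → L.Substructure N}
    (h : ∀ m n, m ≤ n → S m ≤ S n ∧ K.Strong ((S m).comap (S n).subtype.toHom))
    (hcov : ∀ x : N, ∃ n, x ∈ S n) : K.Mem N ∧ ∀ n, K.Strong (S n) := by
  have key : ∀ S : ℕ → L.Substructure N,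
      (∀ m n, m ≤ n → S m ≤ S n ∧ K.Strong ((S m).comap (S n).subtype.toHom)) →
      (∀ x : N, ∃ n, x ∈ S n) → K.Mem N ∧ K.Strong (S 0) := by
    intro S h hcov
    have := K.chain Ordinal.omega0 (ordinalSeq S) Ordinal.isSuccLimit_omega0 ?_
      (ordinalSeq_chain h) fun x => (mem_ordinalSeq_iff x).2 (hcov x)
    · rwa [← Nat.cast_zero, ordinalSeq_natCast] at this
    · intro i _
      exact (K.mem_of_strong _ (h _ _ le_rfl).2).2
  -- The axiom gives strength of the initial member only; start the chain at `S k`.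
  refine ⟨(key S h hcov).1, fun k => ?_⟩
  have := (key (fun n => S (k + n)) (fun m n hmn => h _ _ (by lia)) fun x => ?_).2
  · simpa using this
  · obtain ⟨n, hn⟩ := hcov x
    exact ⟨n, (h n (k + n) (by lia)).1 hn⟩

theorem strong_of_nat_chain {S : ℕ → L.Substructure N} (hS : ∀ n, K.Strong (S n))
    (hmono : Monotone S) (T : L.Substructure N) (hT : ∀ x, x ∈ T ↔ ∃ n, x ∈ S n) :
    K.Strong T := by
  refine K.smooth Ordinal.omega0 (ordinalSeq S) T Ordinal.isSuccLimit_omega0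
    (K.mem_of_strong _ (hS 0)).2 (ordinalSeq_chain fun m n hmn => ⟨hmono hmn, ?_⟩)
    (fun i _ => hS _) fun x => (hT x).trans (mem_ordinalSeq_iff x).symm
  exact K.coherence _ _ (hmono hmn) (hS m) (hS n)

/-- A countable set is exhausted by an increasing sequence of finite tuples. -/
theorem exists_tuples_exhausting (X : Type*) [Countable X] :
    ∃ (n : ℕ → ℕ) (a : ∀ k, Fin (n k) → X),
      Monotone (fun k => range (a k)) ∧ ∀ x, ∃ k, x ∈ range (a k) := by
  obtain ⟨e, he⟩ := Countable.exists_injective_nat X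
  have hfin : ∀ k, {x | e x < k}.Finite := fun k =>
    (Set.finite_Iio k).preimage he.injOn
  choose n a ha using fun k => (hfin k).fin_param
  have ha' : ∀ k, range (a k) = {x | e x < k} := fun k => (ha k).2
  refine ⟨n, a, fun k l hkl => ?_, fun x => ⟨e x + 1, ?_⟩⟩
  · simp only [ha']
    exact fun x hx => lt_of_lt_of_le hx hkl
  · rw [ha']
    exact Nat.lt_succ_self _

/-- In a member of a class with intersections, a countable substructure that contains the closure
of each of its finite tuples is strong. -/
theorem strong_of_cl_le (hint : K.HasIntersections) (hN : K.Mem N) (S : L.Substructure N)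
    [Countable S] (h : ∀ (n : ℕ) (a : Fin n → N), (∀ j, a j ∈ S) → K.cl (range a) ≤ S) :
    K.Strong S := by
  obtain ⟨n, a, hmono, hcov⟩ := exists_tuples_exhausting S
  have hr : ∀ k, range (fun j => (a k j : N)) = Subtype.val '' range (a k) := fun k =>
    range_comp Subtype.val (a k)
  refine strong_of_nat_chain (S := fun k => K.cl (range fun j => (a k j : N)))
    (fun k => hint N hN _) (fun k l hkl => cl_mono ?_) S fun x => ⟨fun hx => ?_, ?_⟩
  · rw [hr, hr]
    exact image_mono (hmono hkl)
  · obtain ⟨k, hk⟩ := hcov ⟨x, hx⟩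
    refine ⟨k, subset_cl _ ?_⟩
    rw [hr]
    exact ⟨_, hk, rfl⟩
  · rintro ⟨k, hk⟩
    exact h _ _ (fun j => (a k j).2) hk

end Chains

end AEC

namespace AEC

open FirstOrder.Language Set FirstOrder.Language.Structure

variable {L : FirstOrder.Language.{u, u}} (K : AEC L)

/-! ### The vocabulary of closure types -/

/-- A family `R` of countable members of `K` that represents every isomorphism type of countable
members of `K`. -/
structure Representatives {ι : Type u} (R : ι → CategoryTheory.Bundled.{u} L.Structure) : Prop where
  countable : ∀ i, Countable (R i)
  mem : ∀ i, K.Mem (R i)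
  exists_equiv : ∀ (M : Type u) [L.Structure M], Countable M → K.Mem M →
    ∃ i, Nonempty (R i ≃[L] M)

theorem exists_representatives (hcount : K.countableModels.Countable) :
    ∃ (ι : Type u) (_ : Countable ι) (R : ι → CategoryTheory.Bundled.{u} L.Structure),
      K.Representatives R := by
  have hc : Countable K.countableModels := hcount.to_subtype
  obtain ⟨e, he⟩ := Countable.exists_injective_nat K.countableModels
  have hrep : ∀ q : K.countableModels, ∃ M : CategoryTheory.Bundled.{u} L.Structure,
      (Countable M ∧ K.Mem M) ∧ Quotient.mk _ M = q.1 := fun q => q.2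
  choose r hr hrq using hrep
  refine ⟨ULift (range e), inferInstance, fun i => r i.down.2.choose, fun i => (hr _).1,
    fun i => (hr _).2, fun M _ hM hMK => ?_⟩
  let q : K.countableModels := ⟨Quotient.mk _ (CategoryTheory.Bundled.of M), _, ⟨hM, hMK⟩, rfl⟩
  refine ⟨⟨⟨e q, q, rfl⟩⟩, ?_⟩
  have h1 : (⟨e q, q, rfl⟩ : range e).2.choose = q :=
    he (⟨e q, q, rfl⟩ : range e).2.choose_spec
  rw [h1]
  exact Quotient.exact (hrq q)

variable {ι : Type u} (R : ι → CategoryTheory.Bundled.{u} L.Structure)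

/-- The `n`-ary closure types: representatives `R i` together with an `n`-tuple whose closure is
all of `R i`.  Such a pair encodes the isomorphism type of a closure `cl(a)` over `a`. -/
structure ClosureType (n : ℕ) : Type u where
  index : ι
  tuple : Fin n → R index
  cl_range : K.cl (range tuple) = ⊤

theorem countable_closureType [Countable ι] (hR : K.Representatives R) (n : ℕ) :
    Countable (K.ClosureType R n) := by
  have := hR.countable
  refine Function.Injective.countable
    (f := fun p : K.ClosureType R n => (⟨p.index, p.tuple⟩ : Σ i, Fin n → R i)) ?_
  rintro ⟨i, t, ht⟩ ⟨j, t', ht'⟩ h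
  cases h
  rfl

/-- The relational vocabulary with a predicate for each closure type. -/
def closureLanguage : FirstOrder.Language.{u, u} :=
  ⟨fun _ => PEmpty, K.ClosureType R⟩

/-- The vocabulary of the functorial expansion. -/
abbrev expandedLanguage : FirstOrder.Language.{u, u} :=
  L.sum (K.closureLanguage R)

/-- The inclusion of the vocabulary of `K` in that of its functorial expansion. -/
abbrev expansion : L →ᴸ K.expandedLanguage R :=
  LHom.sumInl

variable {K R}

/-- The predicate symbol of a closure type. -/
abbrev ClosureType.symbol {n : ℕ} (p : K.ClosureType R n) : (K.expandedLanguage R).Relations n :=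
  Sum.inr p

/-- The tuple `a` of elements of `N` realizes the closure type `(R i, t)` if `t ↦ a` extends to a
`K`-embedding of `R i` in `N`, which is then an isomorphism from `R i` onto `cl(a)`. -/
def ClosureType.Realize {n : ℕ} (p : K.ClosureType R n) {N : Type u} [L.Structure N]
    (a : Fin n → N) : Prop :=
  ∃ h : R p.index ↪[L] N, K.StrongEmb h ∧ ∀ j, h (p.tuple j) = a j

section Realize

variable {M N : Type u} [L.Structure M] [L.Structure N] {n : ℕ}

/-- Realization of closure types is absolute between a structure and its `≤_K`-extensions. -/
theorem realize_comp_iff (hint : K.HasIntersections) {g : M ↪[L] N} (hg : K.StrongEmb g)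
    (p : K.ClosureType R n) (a : Fin n → M) : p.Realize (g ∘ a) ↔ p.Realize a := by
  constructor
  · rintro ⟨h, hh, ha⟩
    have h1 : g ∘ a = h ∘ p.tuple := funext fun j => (ha j).symm
    have h2 : h.toHom.range ≤ g.toHom.range := by
      have h3 : K.cl (range (g ∘ a)) ≤ g.toHom.range := cl_le hg (range_comp_subset_range _ _)
      rw [h1, range_comp, cl_image hint hh, p.cl_range] at h3
      rwa [Hom.range_eq_map]
    obtain ⟨k, rfl⟩ := exists_factor g h h2
    exact ⟨k, (strongEmb_comp_iff hg k).1 hh, fun j => g.injective (ha j)⟩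
  · rintro ⟨h, hh, ha⟩
    exact ⟨g.comp h, (strongEmb_comp_iff hg h).2 hh, fun j => congrArg g (ha j)⟩

/-- Every finite tuple realizes a closure type. -/
theorem exists_realize (hR : K.Representatives R) (hint : K.HasIntersections) (hLS : K.LS = ℵ₀)
    (hN : K.Mem N) (a : Fin n → N) : ∃ p : K.ClosureType R n, p.Realize a := by
  have hcl := hint N hN (range a)
  obtain ⟨i, ⟨e⟩⟩ := hR.exists_equiv (K.cl (range a)) (countable_cl hLS hN (countable_range a))
    (K.mem_of_strong _ hcl).1
  let h : R i ↪[L] N := (K.cl (range a)).subtype.comp e.toEmbedding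
  have hh : K.StrongEmb h := (strongEmb_comp_iff (strongEmb_subtype.2 hcl) _).2
    (strongEmb_equiv e (K.mem_of_strong _ hcl).1)
  let t : Fin n → R i := fun j => e.symm ⟨a j, subset_cl _ (mem_range_self j)⟩
  have ht : ∀ j, h (t j) = a j := fun j =>
    congrArg Subtype.val (e.apply_symm_apply (⟨a j, subset_cl _ (mem_range_self j)⟩ : K.cl _))
  refine ⟨⟨i, t, ?_⟩, h, hh, ht⟩
  refine top_unique fun x _ => ?_
  rw [← mem_cl_image_iff hint hh, ← range_comp, show h ∘ t = a from funext ht]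
  exact (e x).2

end Realize

/-! ### Canonical expansions -/

/-- The structure `N` for the expanded vocabulary is the canonical expansion of its reduct. -/
def IsCanonical (K : AEC L) (R : ι → CategoryTheory.Bundled.{u} L.Structure) (N : Type u)
    [L.Structure N] [(K.expandedLanguage R).Structure N] : Prop :=
  ∀ (n : ℕ) (p : K.ClosureType R n) (a : Fin n → N), RelMap p.symbol a ↔ p.Realize a

/-- The canonical expansion of an `L`-structure, with the predicates of closure types interpreted
as the sets of their realizations. -/
@[reducible]
def canonicalExpansion (K : AEC L) (R : ι → CategoryTheory.Bundled.{u} L.Structure) (N : Type u)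
    [L.Structure N] : (K.expandedLanguage R).Structure N where
  funMap := Sum.elim funMap fun f => PEmpty.elim f
  RelMap := Sum.elim RelMap fun p a => ClosureType.Realize p a

theorem isExpansionOn_canonicalExpansion (N : Type u) [L.Structure N] :
    letI := canonicalExpansion K R N
    (K.expansion R).IsExpansionOn N :=
  letI := canonicalExpansion K R N
  { map_onFunction := fun _ _ => rfl
    map_onRelation := fun _ _ => rfl }

theorem isCanonical_canonicalExpansion (N : Type u) [L.Structure N] :
    letI := canonicalExpansion K R N
    IsCanonical K R N :=
  fun _ _ _ => Iff.rfl

section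

variable {M N : Type u} [L.Structure M] [(K.expandedLanguage R).Structure M]
  [(K.expansion R).IsExpansionOn M] [L.Structure N] [(K.expandedLanguage R).Structure N]
  [(K.expansion R).IsExpansionOn N]

/-- The structure of a reduct is determined by the expansion, so that statements about a pair of
compatible structures reduce to the case of `φ.reduct N`. -/
theorem eq_reduct {L' : FirstOrder.Language.{u, u}} (φ : L →ᴸ L') {N : Type u}
    [s : L.Structure N] [L'.Structure N] [φ.IsExpansionOn N] : s = φ.reduct N :=
  Structure.ext (by ext n f x; exact (φ.map_onFunction f x).symm)
    (by ext n r x; exact iff_of_eq (φ.map_onRelation r x).symm)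

theorem eq_canonicalExpansion {N : Type u} [L.Structure N]
    [s : (K.expandedLanguage R).Structure N] [(K.expansion R).IsExpansionOn N]
    (h : IsCanonical K R N) : s = canonicalExpansion K R N := by
  refine Structure.ext ?_ ?_
  · ext n f x
    rcases f with f | f
    · exact (K.expansion R).map_onFunction f x
    · exact PEmpty.elim f
  · ext n p x
    rcases p with p | p
    · exact iff_of_eq ((K.expansion R).map_onRelation p x)
    · exact h n p x

/-- An embedding for the expanded vocabulary, from an `L`-embedding which preserves the predicates
of closure types. -/
def expandEmbedding (f : M ↪[L] N)
    (hf : ∀ (n : ℕ) (p : K.ClosureType R n) (a : Fin n → M),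
      RelMap p.symbol (f ∘ a) ↔ RelMap p.symbol a) : M ↪[K.expandedLanguage R] N where
  toFun := f
  inj' := f.injective
  map_fun' {n} F x := by
    rcases F with F | F
    · have h1 := (K.expansion R).map_onFunction (M := M) F x
      have h2 := (K.expansion R).map_onFunction (M := N) F (f ∘ x)
      exact (congrArg f h1).trans ((f.map_fun F x).trans h2.symm)
    · exact PEmpty.elim F
  map_rel' {n} p x := by
    rcases p with p | p
    · have h1 := iff_of_eq ((K.expansion R).map_onRelation (M := M) p x)
      have h2 := iff_of_eq ((K.expansion R).map_onRelation (M := N) p (f ∘ x))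
      exact h2.trans ((f.map_rel p x).trans h1.symm)
    · exact hf n p x

/-- The embedding of reducts underlying an embedding for the expanded vocabulary. -/
def reductEmbedding {L' : FirstOrder.Language.{u, u}} (φ : L →ᴸ L') {M N : Type u}
    [L.Structure M] [L'.Structure M] [φ.IsExpansionOn M] [L.Structure N] [L'.Structure N]
    [φ.IsExpansionOn N] (f : M ↪[L'] N) : M ↪[L] N where
  toFun := f
  inj' := f.injective
  map_fun' {n} F x := by
    rw [← φ.map_onFunction, ← φ.map_onFunction]
    exact f.map_fun _ x
  map_rel' {n} p x := by
    rw [← φ.map_onRelation, ← φ.map_onRelation]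
    exact f.map_rel _ x

/-- The isomorphism of reducts underlying an isomorphism for the expanded vocabulary. -/
def reductEquiv {L' : FirstOrder.Language.{u, u}} (φ : L →ᴸ L') {M N : Type u}
    [L.Structure M] [L'.Structure M] [φ.IsExpansionOn M] [L.Structure N] [L'.Structure N]
    [φ.IsExpansionOn N] (f : M ≃[L'] N) : M ≃[L] N where
  toEquiv := f.toEquiv
  map_fun' {n} F x := by
    rw [← φ.map_onFunction, ← φ.map_onFunction]
    exact f.map_fun _ x
  map_rel' {n} p x := by
    rw [← φ.map_onRelation, ← φ.map_onRelation]
    exact f.map_rel _ x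

/-- Every substructure of the reduct is a substructure, since the new symbols are relational. -/
def expandSubstructure (S : L.Substructure N) : (K.expandedLanguage R).Substructure N where
  carrier := S
  fun_mem {n} F x hx := by
    rcases F with F | F
    · have h := (K.expansion R).map_onFunction F x
      exact h ▸ S.fun_mem F x hx
    · exact PEmpty.elim F

theorem isCanonical_of_embedding (hint : K.HasIntersections) (hN : IsCanonical K R N)
    (f : M ↪[K.expandedLanguage R] N) (hf : K.StrongEmb (reductEmbedding (K.expansion R) f)) :
    IsCanonical K R M := by
  intro n p a
  rw [← realize_comp_iff hint hf, ← f.map_rel]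
  exact hN n p (f ∘ a)

end

/-! ### The functorial expansion is an abstract elementary class -/

/-- Membership in the functorial expansion. -/
def ExpandedMem (K : AEC L) (R : ι → CategoryTheory.Bundled.{u} L.Structure) (N : Type u)
    [(K.expandedLanguage R).Structure N] : Prop :=
  letI := (K.expansion R).reduct N
  K.Mem N ∧ IsCanonical K R N

/-- The ordering of the functorial expansion. -/
def ExpandedStrong (K : AEC L) (R : ι → CategoryTheory.Bundled.{u} L.Structure) {N : Type u}
    [(K.expandedLanguage R).Structure N] (S : (K.expandedLanguage R).Substructure N) : Prop :=
  letI := (K.expansion R).reduct N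
  IsCanonical K R N ∧ K.Strong ((K.expansion R).substructureReduct S)

section

variable {M N : Type u} [L.Structure M] [(K.expandedLanguage R).Structure M]
  [(K.expansion R).IsExpansionOn M] [L.Structure N] [(K.expandedLanguage R).Structure N]
  [(K.expansion R).IsExpansionOn N]

theorem expandedMem_iff : ExpandedMem K R N ↔ K.Mem N ∧ IsCanonical K R N := by
  obtain rfl := eq_reduct (K.expansion R) (N := N)
  rfl

theorem expandedStrong_iff (S : (K.expandedLanguage R).Substructure N) :
    ExpandedStrong K R S ↔
      IsCanonical K R N ∧ K.Strong ((K.expansion R).substructureReduct S) := by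
  obtain rfl := eq_reduct (K.expansion R) (N := N)
  rfl

/-- The ordering of the functorial expansion in terms of an embedding with range `S`. -/
theorem expandedStrong_iff_of_range (S : (K.expandedLanguage R).Substructure N)
    (f : M ↪[K.expandedLanguage R] N) (hf : range f = S) :
    ExpandedStrong K R S ↔
      IsCanonical K R N ∧ K.StrongEmb (reductEmbedding (K.expansion R) f) := by
  rw [expandedStrong_iff, StrongEmb]
  have : (K.expansion R).substructureReduct S =
      (reductEmbedding (K.expansion R) f).toHom.range := SetLike.coe_injective hf.symm
  rw [this]

theorem ExpandedStrong.mem_right {S : (K.expandedLanguage R).Substructure N}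
    (h : ExpandedStrong K R S) : ExpandedMem K R N :=
  have h' := (expandedStrong_iff S).1 h
  expandedMem_iff.2 ⟨(K.mem_of_strong _ h'.2).2, h'.1⟩

theorem ExpandedStrong.mem_left (hint : K.HasIntersections)
    {S : (K.expandedLanguage R).Substructure N}
    (h : ExpandedStrong K R S) : ExpandedMem K R S := by
  let _ := (K.expansion R).reduct S
  have h' := (expandedStrong_iff_of_range S S.subtype Subtype.range_coe).1 h
  exact expandedMem_iff.2 ⟨h'.2.mem_left, isCanonical_of_embedding hint h'.1 _ h'.2⟩

theorem expandedMem_of_equiv (hint : K.HasIntersections) (e : M ≃[K.expandedLanguage R] N)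
    (hM : ExpandedMem K R M) : ExpandedMem K R N := by
  have h := expandedMem_iff.1 hM
  exact expandedMem_iff.2 ⟨K.mem_iso ⟨reductEquiv (K.expansion R) e⟩ h.1,
    isCanonical_of_embedding hint h.2 e.symm.toEmbedding
      (strongEmb_equiv (reductEquiv (K.expansion R) e.symm) h.1)⟩

theorem ExpandedMem.mem_reduct {S : (K.expandedLanguage R).Substructure N}
    (h : ExpandedMem K R S) : K.Mem ((K.expansion R).substructureReduct S) := by
  obtain rfl := eq_reduct (K.expansion R) (N := N)
  exact h.1

/-- Being strong in `T` only depends on the reducts, provided that `T` is in the class. -/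
theorem expandedStrong_comap_iff {S T : (K.expandedLanguage R).Substructure N} :
    ExpandedStrong K R (S.comap T.subtype.toHom) ↔ ExpandedMem K R T ∧
      K.Strong (((K.expansion R).substructureReduct S).comap
        ((K.expansion R).substructureReduct T).subtype.toHom) := by
  obtain rfl := eq_reduct (K.expansion R) (N := N)
  let _ := (K.expansion R).reduct T
  constructor
  · intro h
    exact ⟨⟨(K.mem_of_strong _ h.2).2, h.1⟩, h.2⟩
  · intro h
    exact ⟨h.1.2, h.2⟩

/-- A structure is canonical if each of its finite tuples lies in a canonical substructure whose
reduct is strong. -/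
theorem isCanonical_of_forall_exists (hint : K.HasIntersections)
    (h : ∀ (n : ℕ) (a : Fin n → N), ∃ S : (K.expandedLanguage R).Substructure N,
      ExpandedMem K R S ∧ K.Strong ((K.expansion R).substructureReduct S) ∧ ∀ j, a j ∈ S) :
    IsCanonical K R N := by
  intro n p a
  obtain ⟨S, hS, hSN, ha⟩ := h n a
  let _ := (K.expansion R).reduct S
  have hf : K.StrongEmb (reductEmbedding (K.expansion R) S.subtype) := by
    have : (K.expansion R).substructureReduct S =
        (reductEmbedding (K.expansion R) S.subtype).toHom.range :=
      SetLike.coe_injective Subtype.range_coe.symm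
    rwa [StrongEmb, ← this]
  have h1 := realize_comp_iff hint hf p fun j => ⟨a j, ha j⟩
  have h2 := S.subtype.map_rel p.symbol fun j => ⟨a j, ha j⟩
  exact h2.trans ((hS.2 n p _).trans h1.symm)

end

theorem card_expandedLanguage [Countable ι] (hR : K.Representatives R) (hL : L.card ≤ ℵ₀) :
    (K.expandedLanguage R).card ≤ ℵ₀ := by
  have h2 : (K.closureLanguage R).card ≤ ℵ₀ := by
    have h3 : ∀ n, Countable ((K.closureLanguage R).Relations n) := countable_closureType K R hR
    have h4 : ∀ n, Countable ((K.closureLanguage R).Functions n) := fun n =>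
      inferInstanceAs (Countable PEmpty)
    exact mk_le_aleph0_iff.2 (inferInstanceAs (Countable (_ ⊕ _)))
  rw [card_sum, lift_id, lift_id]
  exact add_le_aleph0.2 ⟨hL, h2⟩

/-- The functorial expansion of a class with intersections by the predicates of closure types. -/
def expandedAEC (K : AEC L) (R : ι → CategoryTheory.Bundled.{u} L.Structure)
    (hint : K.HasIntersections) (hcard : (K.expandedLanguage R).card ≤ ℵ₀) (hLS : K.LS = ℵ₀) :
    AEC (K.expandedLanguage R) where
  Mem N := ExpandedMem K R N
  Strong S := ExpandedStrong K R S
  mem_iso {M N} _ _ := fun ⟨e⟩ h => by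
    let _ := (K.expansion R).reduct M
    let _ := (K.expansion R).reduct N
    exact expandedMem_of_equiv hint e h
  strong_iso {M N} _ _ e S h := by
    let _ := (K.expansion R).reduct M
    let _ := (K.expansion R).reduct N
    let e' := reductEquiv (K.expansion R) e
    refine ⟨(expandedMem_of_equiv hint e h.mem_right).2, ?_⟩
    exact K.strong_iso e' _ h.2
  mem_of_strong {N} _ S h := by
    let _ := (K.expansion R).reduct N
    exact ⟨h.mem_left hint, h.mem_right⟩
  strong_refl N _ h := ⟨h.2, by
    let _ := (K.expansion R).reduct N
    exact K.strong_refl N h.1⟩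
  strong_trans {N} _ S T hST h hT := by
    let _ := (K.expansion R).reduct N
    exact ⟨hT.1, K.strong_trans _ _ hST (expandedStrong_comap_iff.1 h).2 hT.2⟩
  coherence {N} _ S T hST hS hT := by
    let _ := (K.expansion R).reduct N
    exact expandedStrong_comap_iff.2 ⟨hT.mem_left hint, K.coherence _ _ hST hS.2 hT.2⟩
  chain {M} _ δ S hδ hS h hcov := by
    let _ := (K.expansion R).reduct M
    let T : Ordinal.{u} → L.Substructure M := fun i => (K.expansion R).substructureReduct (S i)
    -- Every member of the chain is strong in the union, as one sees by starting the chain there.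
    have key : ∀ k < δ, K.Mem M ∧ K.Strong (T k) := by
      intro k hk
      have := K.chain δ (fun i => T (max k i)) hδ
        (fun i hi => (hS _ (max_lt hk hi)).mem_reduct)
        (fun i j hij hj => ?_) fun x => ?_
      · simpa using this
      · have h1 := h (max k i) (max k j) (max_le_max le_rfl hij) (max_lt hk hj)
        exact ⟨h1.1, (expandedStrong_comap_iff.1 h1.2).2⟩
      · obtain ⟨i, hi, hx⟩ := hcov x
        exact ⟨i, hi, (h i (max k i) (le_max_right _ _) (max_lt hk hi)).1 hx⟩
    have h0 : (0 : Ordinal.{u}) < δ := hδ.bot_lt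
    have hcan : IsCanonical K R M := by
      refine isCanonical_of_forall_exists hint fun n a => ?_
      choose i hi hx using fun j => hcov (a j)
      obtain ⟨k, hk, hik⟩ : ∃ k < δ, ∀ j, i j ≤ k := by
        refine ⟨Finset.univ.sup i, (Finset.sup_lt_iff h0).2 fun j _ => hi j, fun j => ?_⟩
        exact Finset.le_sup (Finset.mem_univ j)
      exact ⟨S k, hS k hk, (key k hk).2, fun j => (h _ _ (hik j) hk).1 (hx j)⟩
    exact ⟨⟨(key 0 h0).1, hcan⟩, hcan, (key 0 h0).2⟩
  smooth {N} _ δ S T hδ hN h hS hT := by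
    let _ := (K.expansion R).reduct N
    refine ⟨hN.2, K.smooth δ (fun i => (K.expansion R).substructureReduct (S i)) _ hδ hN.1
      (fun i j hij hj => ?_) (fun i hi => (hS i hi).2) hT⟩
    have h1 := h i j hij hj
    exact ⟨h1.1, (expandedStrong_comap_iff.1 h1.2).2⟩
  lowenheim_skolem := by
    refine ⟨ℵ₀, by simpa using hcard, fun N _ hN A => ?_⟩
    let _ := (K.expansion R).reduct N
    obtain ⟨S, hAS, hS, hc⟩ := (LS_spec K).2 N hN.1 A
    exact ⟨expandSubstructure S, hAS, ⟨hN.2, hS⟩, hc.trans_eq (by rw [hLS])⟩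

theorem LS_expandedAEC (hint : K.HasIntersections) (hcard : (K.expandedLanguage R).card ≤ ℵ₀)
    (hLS : K.LS = ℵ₀) : (expandedAEC K R hint hcard hLS).LS = ℵ₀ := by
  refine LS_eq_aleph0 hcard fun N _ hN A => ?_
  let _ := (K.expansion R).reduct N
  obtain ⟨S, hAS, hS, hc⟩ := (LS_spec K).2 N hN.1 A
  exact ⟨expandSubstructure S, hAS, ⟨hN.2, hS⟩, hc.trans_eq (by rw [hLS])⟩

theorem isFunctorialExpansion_expandedAEC (hint : K.HasIntersections)
    (hcard : (K.expandedLanguage R).card ≤ ℵ₀) (hLS : K.LS = ℵ₀) :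
    K.IsFunctorialExpansion (K.expansion R) (expandedAEC K R hint hcard hLS) where
  injective := LHom.sumInl_injective
  reduct_mem M _ _ _ h := (expandedMem_iff.1 h).1
  existsUnique M _ hM := by
    refine ⟨canonicalExpansion K R M, ⟨isExpansionOn_canonicalExpansion M, ?_⟩, ?_⟩
    · let _ := canonicalExpansion K R M
      have := isExpansionOn_canonicalExpansion (K := K) (R := R) M
      exact expandedMem_iff.2 ⟨hM, isCanonical_canonicalExpansion M⟩
    · rintro s ⟨h1, h2⟩
      exact eq_canonicalExpansion (expandedMem_iff.1 h2).2
  iso M N _ _ _ _ _ _ hM hN f := by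
    have hM' := expandedMem_iff.1 hM
    have hN' := expandedMem_iff.1 hN
    have h1 : ∀ (n : ℕ) (p : K.ClosureType R n) (a : Fin n → M),
        RelMap p.symbol (f ∘ a) ↔ RelMap p.symbol a := by
      intro n p a
      rw [hM'.2, hN'.2]
      exact realize_comp_iff hint (strongEmb_equiv f hN'.1) p a
    let g := expandEmbedding f.toEmbedding h1
    exact ⟨{ f.toEquiv with map_fun' := g.map_fun', map_rel' := g.map_rel' }, fun _ => rfl⟩
  mono N _ _ _ hN S hS := by
    have h : ExpandedStrong K R (expandSubstructure S (K := K) (R := R)) :=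
      (expandedStrong_iff _).2 ⟨(expandedMem_iff.1 hN).2, hS⟩
    exact ⟨expandSubstructure S, rfl, h.mem_left hint⟩
  strong_iff N _ _ _ S := by
    refine ⟨fun h => ⟨h.mem_left hint, h.mem_right, ((expandedStrong_iff S).1 h).2⟩, fun h => ?_⟩
    exact (expandedStrong_iff S).2 ⟨(expandedMem_iff.1 h.2.1).2, h.2.2⟩

end AEC

/-! ### Back and forth -/

/-- The back-and-forth construction for a relation `G` between finite tuples of two countable
sets.  The bijection it produces is locally a member of `G`. -/
theorem exists_equiv_of_back_and_forth {X Y : Type*} [Countable X] [Countable Y]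
    (G : ∀ n, (Fin n → X) → (Fin n → Y) → Prop)
    (eq_iff : ∀ n a t, G n a t → ∀ j k, a j = a k ↔ t j = t k)
    (forth : ∀ n a t, G n a t → ∀ x, ∃ y, G (n + 1) (Fin.cons x a) (Fin.cons y t))
    (back : ∀ n a t, G n a t → ∀ y, ∃ x, G (n + 1) (Fin.cons x a) (Fin.cons y t))
    {n₀ : ℕ} {a₀ : Fin n₀ → X} {t₀ : Fin n₀ → Y} (h₀ : G n₀ a₀ t₀) :
    ∃ e : X ≃ Y, e ∘ a₀ = t₀ ∧ ∀ (m : ℕ) (d : Fin m → X), ∃ (n : ℕ) (a : Fin n → X) (t : Fin n → Y)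
      (σ : Fin m → Fin n), G n a t ∧ a ∘ σ = d ∧ t ∘ σ = e ∘ d := by
  let State := {s : Σ n, (Fin n → X) × (Fin n → Y) // G s.1 s.2.1 s.2.2}
  let graph : State → Set (X × Y) := fun s => Set.range fun j => (s.1.2.1 j, s.1.2.2 j)
  have hcons : ∀ (s s' : State) (x : X) (y : Y),
      s'.1 = ⟨s.1.1 + 1, Fin.cons x s.1.2.1, Fin.cons y s.1.2.2⟩ →
      graph s ⊆ graph s' ∧ (x, y) ∈ graph s' := by
    rintro s ⟨_, h⟩ x y rfl
    refine ⟨?_, ⟨0, rfl⟩⟩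
    rintro _ ⟨j, rfl⟩
    exact ⟨j.succ, rfl⟩
  have hstep : ∀ (s : State) (r : Option (X ⊕ Y)), ∃ s' : State, graph s ⊆ graph s' ∧
      (∀ x, r = some (Sum.inl x) → ∃ y, (x, y) ∈ graph s') ∧
      (∀ y, r = some (Sum.inr y) → ∃ x, (x, y) ∈ graph s') := by
    rintro s (_ | x | y)
    · exact ⟨s, subset_rfl, by simp, by simp⟩
    · obtain ⟨y, hy⟩ := forth _ _ _ s.2 x
      have h := hcons s ⟨⟨_, _, _⟩, hy⟩ x y rfl
      refine ⟨⟨⟨_, _, _⟩, hy⟩, h.1, ?_, by simp⟩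
      intro x' hx'
      obtain rfl : x = x' := by simpa using hx'
      exact ⟨y, h.2⟩
    · obtain ⟨x, hx⟩ := back _ _ _ s.2 y
      have h := hcons s ⟨⟨_, _, _⟩, hx⟩ x y rfl
      refine ⟨⟨⟨_, _, _⟩, hx⟩, h.1, by simp, ?_⟩
      intro y' hy'
      obtain rfl : y = y' := by simpa using hy'
      exact ⟨x, h.2⟩
  choose step hsub hl hr using hstep
  obtain ⟨r, hr_surj⟩ := exists_surjective_nat (Option (X ⊕ Y))
  let s : ℕ → State := fun k => Nat.rec ⟨⟨n₀, a₀, t₀⟩, h₀⟩ (fun k s => step s (r k)) k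
  have hmono : Monotone fun k => graph (s k) := monotone_nat_of_le_succ fun k => hsub _ _
  have hX : ∀ x, ∃ y k, (x, y) ∈ graph (s k) := by
    intro x
    obtain ⟨k, hk⟩ := hr_surj (some (Sum.inl x))
    obtain ⟨y, hy⟩ := hl (s k) (r k) x hk
    exact ⟨y, k + 1, hy⟩
  have hY : ∀ y, ∃ x k, (x, y) ∈ graph (s k) := by
    intro y
    obtain ⟨k, hk⟩ := hr_surj (some (Sum.inr y))
    obtain ⟨x, hx⟩ := hr (s k) (r k) y hk
    exact ⟨x, k + 1, hx⟩
  have huniq : ∀ x y x' y' k k', (x, y) ∈ graph (s k) → (x', y') ∈ graph (s k') →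
      (x = x' ↔ y = y') := by
    intro x y x' y' k k' h h'
    obtain ⟨j, hj⟩ := hmono (le_max_left k k') h
    obtain ⟨j', hj'⟩ := hmono (le_max_right k k') h'
    have := eq_iff _ _ _ (s (max k k')).2 j j'
    simp only [Prod.mk.injEq] at hj hj'
    rwa [hj.1, hj.2, hj'.1, hj'.2] at this
  choose f kf hf using hX
  choose g kg hg using hY
  refine ⟨⟨f, g, fun x => (huniq _ _ _ _ _ _ (hg (f x)) (hf x)).2 rfl,
    fun y => (huniq _ _ _ _ _ _ (hf (g y)) (hg y)).1 rfl⟩,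
    funext fun j => (huniq _ _ _ _ _ 0 (hf (a₀ j)) ⟨j, rfl⟩).1 rfl, fun m d => ?_⟩
  let k := Finset.univ.sup fun i => kf (d i)
  have hk : ∀ i, (d i, f (d i)) ∈ graph (s k) := fun i =>
    hmono (Finset.le_sup (f := fun i => kf (d i)) (Finset.mem_univ i)) (hf (d i))
  choose σ hσ using hk
  exact ⟨_, _, _, σ, (s k).2, funext fun i => congrArg Prod.fst (hσ i),
    funext fun i => congrArg Prod.snd (hσ i)⟩

namespace AEC

open FirstOrder.Language Set FirstOrder.Language.Structure

variable {L : FirstOrder.Language.{u, u}} {K : AEC L} {ι : Type u}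
  {R : ι → CategoryTheory.Bundled.{u} L.Structure}

/-! ### Axiomatization of the countable members of the expansion -/

/-- The closure type obtained by adding an element at the head of the tuple. -/
def ClosureType.cons {n : ℕ} (p : K.ClosureType R n) (y : R p.index) : K.ClosureType R (n + 1) :=
  ⟨p.index, Fin.cons y p.tuple, top_unique <| p.cl_range.ge.trans <| cl_mono <| by
    rw [Fin.range_cons]
    exact subset_insert _ _⟩

theorem ClosureType.realize_cons_iff {n : ℕ} (p : K.ClosureType R n) (y : R p.index) {N : Type u}
    [L.Structure N] (a : Fin n → N) (b : N) :
    (p.cons y).Realize (Fin.cons b a : Fin (n + 1) → N) ↔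
      ∃ h : R p.index ↪[L] N, K.StrongEmb h ∧ h ∘ p.tuple = a ∧ h y = b := by
  constructor
  · rintro ⟨h, hh, ha⟩
    exact ⟨h, hh, funext fun j => ha j.succ, ha 0⟩
  · rintro ⟨h, hh, ha, hb⟩
    exact ⟨h, hh, Fin.cases hb (congrFun ha)⟩

/-- Membership in the closure of a tuple is expressed by closure types. -/
theorem mem_cl_iff_exists_realize (hR : K.Representatives R) (hint : K.HasIntersections)
    (hLS : K.LS = ℵ₀) {N : Type u} [L.Structure N] (hN : K.Mem N) {n : ℕ} (a : Fin n → N) (b : N) :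
    b ∈ K.cl (range a) ↔ ∃ (p : K.ClosureType R n) (y : R p.index),
      (p.cons y).Realize (Fin.cons b a : Fin (n + 1) → N) := by
  constructor
  · intro hb
    obtain ⟨p, h, hh, ha⟩ := exists_realize hR hint hLS hN a
    have h1 : K.cl (range a) ≤ h.toHom.range := cl_le hh <| by
      rintro _ ⟨j, rfl⟩
      exact ⟨_, ha j⟩
    obtain ⟨y, hy⟩ := h1 hb
    exact ⟨p, y, (p.realize_cons_iff y a b).2 ⟨h, hh, funext ha, hy⟩⟩
  · rintro ⟨p, y, hy⟩
    obtain ⟨h, hh, rfl, rfl⟩ := (p.realize_cons_iff y a b).1 hy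
    rw [range_comp, mem_cl_image_iff hint hh, p.cl_range]
    trivial

/-- `L_{ω₁ω}`-axioms for the countable members of the functorial expansion: every finite tuple has
a closure type, a tuple of closure type `(R i, t)` has the atomic type of `t` in the canonical
expansion of `R i`, and each element of `R i` has a counterpart over the tuple. -/
structure ClosureAxioms (K : AEC L) (R : ι → CategoryTheory.Bundled.{u} L.Structure)
    (N : Type u) [(K.expandedLanguage R).Structure N] : Prop where
  exists_type : ∀ (n : ℕ) (a : Fin n → N), ∃ p : K.ClosureType R n, RelMap p.symbol a
  eq_iff : ∀ (n : ℕ) (a : Fin n → N) (p : K.ClosureType R n), RelMap p.symbol a →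
    ∀ j k, a j = a k ↔ p.tuple j = p.tuple k
  rel_iff : ∀ (n : ℕ) (a : Fin n → N) (p : K.ClosureType R n), RelMap p.symbol a →
    ∀ (m : ℕ) (r : L.Relations m) (σ : Fin m → Fin n),
      RelMap ((K.expansion R).onRelation r) (a ∘ σ) ↔ RelMap r (p.tuple ∘ σ)
  fun_iff : ∀ (n : ℕ) (a : Fin n → N) (p : K.ClosureType R n), RelMap p.symbol a →
    ∀ (m : ℕ) (f : L.Functions m) (σ : Fin m → Fin n) (k : Fin n),
      funMap ((K.expansion R).onFunction f) (a ∘ σ) = a k ↔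
        funMap f (p.tuple ∘ σ) = p.tuple k
  type_iff : ∀ (n : ℕ) (a : Fin n → N) (p : K.ClosureType R n), RelMap p.symbol a →
    ∀ (m : ℕ) (q : K.ClosureType R m) (σ : Fin m → Fin n),
      RelMap q.symbol (a ∘ σ) ↔ q.Realize (p.tuple ∘ σ)
  extend : ∀ (n : ℕ) (a : Fin n → N) (p : K.ClosureType R n), RelMap p.symbol a →
    ∀ y : R p.index, ∃ b : N, RelMap (p.cons y).symbol (Fin.cons b a : Fin (n + 1) → N)

/-- The element `b` belongs to the closure of `a`, according to the predicates of closure types. -/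
def InClosure (K : AEC L) (R : ι → CategoryTheory.Bundled.{u} L.Structure) {N : Type u}
    [(K.expandedLanguage R).Structure N] {n : ℕ} (a : Fin n → N) (b : N) : Prop :=
  ∃ (p : K.ClosureType R n) (y : R p.index),
    RelMap (p.cons y).symbol (Fin.cons b a : Fin (n + 1) → N)

theorem IsCanonical.inClosure_iff (hR : K.Representatives R) (hint : K.HasIntersections)
    (hLS : K.LS = ℵ₀) {N : Type u} [L.Structure N] [(K.expandedLanguage R).Structure N]
    (hN : K.Mem N) (hcan : IsCanonical K R N) {n : ℕ} (a : Fin n → N) (b : N) :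
    InClosure K R a b ↔ b ∈ K.cl (range a) := by
  rw [mem_cl_iff_exists_realize hR hint hLS hN]
  exact exists_congr fun p => exists_congr fun y => hcan _ _ _

theorem IsCanonical.closureAxioms (hR : K.Representatives R) (hint : K.HasIntersections)
    (hLS : K.LS = ℵ₀) {N : Type u} [L.Structure N] [(K.expandedLanguage R).Structure N]
    [(K.expansion R).IsExpansionOn N] (hN : K.Mem N) (hcan : IsCanonical K R N) :
    ClosureAxioms K R N where
  exists_type n a := (exists_realize hR hint hLS hN a).imp fun p hp => (hcan n p a).2 hp
  eq_iff n a p hp j k := by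
    obtain ⟨h, hh, ha⟩ := (hcan n p a).1 hp
    rw [← ha, ← ha, h.injective.eq_iff]
  rel_iff n a p hp m r σ := by
    obtain ⟨h, hh, ha⟩ := (hcan n p a).1 hp
    obtain rfl : h ∘ p.tuple = a := funext ha
    rw [← h.map_rel]
    exact iff_of_eq ((K.expansion R).map_onRelation r _)
  fun_iff n a p hp m f σ k := by
    obtain ⟨h, hh, ha⟩ := (hcan n p a).1 hp
    obtain rfl : h ∘ p.tuple = a := funext ha
    rw [← h.injective.eq_iff, h.map_fun]
    exact iff_of_eq (congrArg (· = _) ((K.expansion R).map_onFunction f _))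
  type_iff n a p hp m q σ := by
    obtain ⟨h, hh, ha⟩ := (hcan n p a).1 hp
    obtain rfl : h ∘ p.tuple = a := funext ha
    rw [hcan, ← realize_comp_iff hint hh]
    rfl
  extend n a p hp y := by
    obtain ⟨h, hh, ha⟩ := (hcan n p a).1 hp
    exact ⟨h y, (hcan _ _ _).2 ((p.realize_cons_iff y a _).2 ⟨h, hh, funext ha, rfl⟩)⟩

namespace ClosureAxioms

section

variable {N : Type u} [(K.expandedLanguage R).Structure N] {n m : ℕ}

/-- Finitely many elements are listed by a single tuple, which has a closure type. -/
theorem exists_type_of_finite (A : ClosureAxioms K R N) {s : Set N} (hs : s.Finite) :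
    ∃ (k : ℕ) (e : Fin k → N) (p : K.ClosureType R k), RelMap p.symbol e ∧ s = range e := by
  obtain ⟨k, e, -, he⟩ := hs.fin_param
  obtain ⟨p, hp⟩ := A.exists_type k e
  exact ⟨k, e, p, hp, he.symm⟩

/-- Within a tuple of a given closure type, the predicate `InClosure` is determined by the
representative. -/
theorem inClosure_comp_iff (A : ClosureAxioms K R N) (hR : K.Representatives R)
    (hint : K.HasIntersections) (hLS : K.LS = ℵ₀) {e : Fin n → N} {p : K.ClosureType R n}
    (hp : RelMap p.symbol e) (σ : Fin m → Fin n) (k : Fin n) :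
    InClosure K R (e ∘ σ) (e k) ↔ p.tuple k ∈ K.cl (range (p.tuple ∘ σ)) := by
  rw [mem_cl_iff_exists_realize hR hint hLS (hR.mem _)]
  refine exists_congr fun q => exists_congr fun y => ?_
  rw [← Fin.comp_cons, ← Fin.comp_cons]
  exact A.type_iff n e p hp (m + 1) (q.cons y) (Fin.cons k σ)

theorem inClosure_of_mem_range (A : ClosureAxioms K R N) (hR : K.Representatives R)
    (hint : K.HasIntersections) (hLS : K.LS = ℵ₀) {a : Fin n → N} {b : N} (hb : b ∈ range a) :
    InClosure K R a b := by
  obtain ⟨j, rfl⟩ := hb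
  obtain ⟨p, hp⟩ := A.exists_type n a
  exact (A.inClosure_comp_iff hR hint hLS hp id j).2 (subset_cl _ ⟨j, rfl⟩)

/-- Closures are transitive: list all elements involved in one tuple and use its representative. -/
theorem inClosure_trans (A : ClosureAxioms K R N) (hR : K.Representatives R)
    (hint : K.HasIntersections) (hLS : K.LS = ℵ₀) {a : Fin n → N} {c : Fin m → N} {d : N}
    (hc : ∀ j, InClosure K R a (c j)) (hd : InClosure K R c d) : InClosure K R a d := by
  obtain ⟨k, e, p, hp, he⟩ := A.exists_type_of_finite
    (((finite_range a).union (finite_range c)).insert d)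
  have ha : ∀ j, ∃ i, e i = a j := fun j =>
    he.subset (mem_insert_of_mem _ (Or.inl (mem_range_self j)))
  have hc' : ∀ j, ∃ i, e i = c j := fun j =>
    he.subset (mem_insert_of_mem _ (Or.inr (mem_range_self j)))
  choose σ hσ using ha
  choose τ hτ using hc'
  obtain ⟨i, rfl⟩ := he.subset (mem_insert d _)
  obtain rfl : e ∘ σ = a := funext hσ
  obtain rfl : e ∘ τ = c := funext hτ
  rw [A.inClosure_comp_iff hR hint hLS hp] at hd ⊢
  have h1 : K.cl (range (p.tuple ∘ τ)) ≤ K.cl (range (p.tuple ∘ σ)) := by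
    refine cl_le (hint _ (hR.mem _) _) ?_
    rintro _ ⟨j, rfl⟩
    exact (A.inClosure_comp_iff hR hint hLS hp σ (τ j)).1 (hc j)
  exact h1 hd

/-- An element of the closure of a tuple has a counterpart in the representative of each closure
type of the tuple. -/
theorem exists_cons_of_inClosure (A : ClosureAxioms K R N)
    {a : Fin n → N} {p : K.ClosureType R n} (hp : RelMap p.symbol a) {b : N}
    (hb : InClosure K R a b) :
    ∃ y, RelMap (p.cons y).symbol (Fin.cons b a : Fin (n + 1) → N) := by
  obtain ⟨q, z, hz⟩ := hb
  obtain ⟨h, hh, ha⟩ := (A.type_iff _ _ _ hz n p Fin.succ).1 hp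
  have h1 : h ∘ p.tuple = q.tuple := funext ha
  have h2 : K.cl (range q.tuple) ≤ h.toHom.range := cl_le hh (h1 ▸ range_comp_subset_range _ _)
  rw [q.cl_range] at h2
  obtain ⟨y, hy⟩ := h2 (show z ∈ _ from trivial)
  exact ⟨y, (A.type_iff _ _ _ hz (n + 1) (p.cons y) id).2
    ((p.realize_cons_iff y _ _).2 ⟨h, hh, h1, hy⟩)⟩

end

section

variable {N : Type u} [L.Structure N] [(K.expandedLanguage R).Structure N]
  [(K.expansion R).IsExpansionOn N] [Countable N] {n m : ℕ}

/-- In a countable model of the axioms, the closure of a tuple of closure type `(R i, t)` is a copy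
of the canonical expansion of `R i`. -/
theorem exists_embedding (A : ClosureAxioms K R N) (hR : K.Representatives R)
    (hint : K.HasIntersections) (hLS : K.LS = ℵ₀) {a : Fin n → N} {p : K.ClosureType R n}
    (hp : RelMap p.symbol a) :
    ∃ h : R p.index ↪[L] N, h ∘ p.tuple = a ∧ (∀ b, b ∈ range h ↔ InClosure K R a b) ∧
      ∀ (m : ℕ) (q : K.ClosureType R m) (x : Fin m → R p.index),
        RelMap q.symbol (h ∘ x) ↔ q.Realize x := by
  have := hR.countable p.index
  let X := {b // InClosure K R a b}
  -- The tuples `c` and `t` match if they have the same closure type and extend `a` and `p.tuple`.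
  let G : ∀ n, (Fin n → X) → (Fin n → R p.index) → Prop := fun l c t =>
    ∃ ht : K.cl (range t) = ⊤, RelMap (ClosureType.mk p.index t ht).symbol (fun j => (c j : N)) ∧
      ∃ σ : Fin n → Fin l, (fun j => (c (σ j) : N)) = a ∧ t ∘ σ = p.tuple
  have hG₀ : G n (fun j => ⟨a j, A.inClosure_of_mem_range hR hint hLS (mem_range_self j)⟩)
      p.tuple := ⟨p.cl_range, hp, id, rfl, rfl⟩
  have hcons : ∀ {l : ℕ} (x : X) (c : Fin l → X),
      (fun j => ((Fin.cons x c : Fin (l + 1) → X) j : N)) = Fin.cons (x : N) fun j => (c j : N) :=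
    fun x c => Fin.comp_cons (Subtype.val : X → N) x c
  have hG_eq : ∀ l c t, G l c t → ∀ j k, c j = c k ↔ t j = t k := by
    rintro l c t ⟨ht, hct, -⟩ j k
    rw [← A.eq_iff _ _ _ hct j k, Subtype.coe_inj]
  have forth : ∀ l c t, G l c t → ∀ x, ∃ y, G (l + 1) (Fin.cons x c) (Fin.cons y t) := by
    rintro l c t ⟨ht, hct, σ, hσ, hσ'⟩ x
    obtain ⟨y, hy⟩ := A.exists_cons_of_inClosure hct (b := x) <|
      A.inClosure_trans hR hint hLS (fun j => A.inClosure_of_mem_range hR hint hLS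
        ⟨σ j, congrFun hσ j⟩) x.2
    refine ⟨y, (ClosureType.cons ⟨_, t, ht⟩ y).cl_range, ?_, Fin.succ ∘ σ, hσ, hσ'⟩
    rw [hcons]
    exact hy
  have back : ∀ l c t, G l c t → ∀ y, ∃ x, G (l + 1) (Fin.cons x c) (Fin.cons y t) := by
    rintro l c t ⟨ht, hct, σ, hσ, hσ'⟩ y
    obtain ⟨b, hb⟩ := A.extend _ _ _ hct y
    have hba : InClosure K R a b := by
      have h1 := A.inClosure_comp_iff hR hint hLS hb (Fin.succ ∘ σ) 0
      have h2 : (Fin.cons b (fun j => (c j : N)) : Fin (l + 1) → N) ∘ Fin.succ ∘ σ = a := hσ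
      have h3 : (Fin.cons y t : Fin (l + 1) → R p.index) ∘ Fin.succ ∘ σ = p.tuple := hσ'
      rw [h2] at h1
      refine h1.2 ?_
      change y ∈ K.cl (range ((Fin.cons y t : Fin (l + 1) → R p.index) ∘ Fin.succ ∘ σ))
      rw [h3, p.cl_range]
      trivial
    refine ⟨⟨b, hba⟩, (ClosureType.cons ⟨_, t, ht⟩ y).cl_range, ?_, Fin.succ ∘ σ, hσ, hσ'⟩
    rw [hcons]
    exact hb
  obtain ⟨e, he₀, he⟩ := exists_equiv_of_back_and_forth G hG_eq forth back hG₀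
  have htuple : ∀ {l : ℕ} (x : Fin l → R p.index), ∃ (k : ℕ) (c : Fin k → N)
      (t : Fin k → R p.index) (ht : K.cl (range t) = ⊤) (σ : Fin l → Fin k),
      RelMap (ClosureType.mk p.index t ht).symbol c ∧
        c ∘ σ = (fun j => (e.symm (x j) : N)) ∧ t ∘ σ = x := by
    intro l x
    obtain ⟨k, c, t, σ, ⟨ht, hct, -⟩, hc, hσ⟩ := he l fun j => e.symm (x j)
    refine ⟨k, _, t, ht, σ, hct, funext fun j => congrArg Subtype.val (congrFun hc j), ?_⟩
    rw [hσ]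
    exact funext fun j => e.apply_symm_apply (x j)
  let h : R p.index ↪[L] N :=
    { toFun := fun y => (e.symm y : N)
      inj' := Subtype.val_injective.comp e.symm.injective
      map_fun' := fun {l} f x => by
        obtain ⟨k, c, t, ht, σ, hct, hc, hσ⟩ := htuple (Fin.cons (funMap f x) x)
        have h1 := (A.fun_iff _ _ _ hct l f (σ ∘ Fin.succ) (σ 0)).2 <| by
          have h2 : t ∘ σ ∘ Fin.succ = x := congrArg (fun g => g ∘ Fin.succ) hσ
          have h3 : t (σ 0) = funMap f x := congrFun hσ 0
          exact (congrArg (funMap f) h2).trans h3.symm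
        rw [LHom.map_onFunction] at h1
        have h2 : c ∘ σ ∘ Fin.succ = fun j => (e.symm (x j) : N) :=
          congrArg (fun g => g ∘ Fin.succ) hc
        have h3 : c (σ 0) = e.symm (funMap f x) := congrFun hc 0
        rw [h2, h3] at h1
        exact h1.symm
      map_rel' := fun {l} r x => by
        obtain ⟨k, c, t, ht, σ, hct, hc, hσ⟩ := htuple x
        have h1 := A.rel_iff _ _ _ hct l r σ
        rw [LHom.map_onRelation, hc] at h1
        exact h1.trans (iff_of_eq (congrArg (RelMap r) hσ)) }
  refine ⟨h, ?_, ?_, ?_⟩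
  · have h1 : p.tuple = e ∘ _ := he₀.symm
    rw [h1]
    exact funext fun j => congrArg Subtype.val (e.symm_apply_apply _)
  · intro b
    constructor
    · rintro ⟨y, rfl⟩
      exact (e.symm y).2
    · intro hb
      exact ⟨e ⟨b, hb⟩, congrArg Subtype.val (e.symm_apply_apply ⟨b, hb⟩)⟩
  · intro m q x
    obtain ⟨k, c, t, ht, σ, hct, hc, hσ⟩ := htuple x
    have h1 := A.type_iff _ _ _ hct m q σ
    rw [hc] at h1
    exact h1.trans (iff_of_eq (congrArg q.Realize hσ))

/-- A countable model of the axioms is a canonical expansion of a member of `K`: it is the union of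
an increasing sequence of closures of finite tuples. -/
theorem mem_and_isCanonical (A : ClosureAxioms K R N) (hR : K.Representatives R)
    (hint : K.HasIntersections) (hLS : K.LS = ℵ₀) : K.Mem N ∧ IsCanonical K R N := by
  choose p hp using A.exists_type
  choose h hh_tuple hh_range hh_rel using fun n a => A.exists_embedding hR hint hLS (hp n a)
  let S : ∀ n, (Fin n → N) → L.Substructure N := fun n a => (h n a).toHom.range
  have hS : ∀ n a b, b ∈ S n a ↔ InClosure K R a b := hh_range
  have hsub : ∀ (n m) (a : Fin n → N) (c : Fin m → N), (∀ j, a j ∈ S m c) → S n a ≤ S m c := by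
    intro n m a c hac b hb
    exact (hS _ _ _).2 <| A.inClosure_trans hR hint hLS (fun j => (hS _ _ _).1 (hac j))
      ((hS _ _ _).1 hb)
  have hstrong : ∀ (n m) (a : Fin n → N) (c : Fin m → N), (∀ j, a j ∈ S m c) →
      K.Strong ((S n a).comap (S m c).subtype.toHom) := by
    intro n m a c hac
    choose x hx using hac
    have hx' : h m c ∘ x = a := funext hx
    have h1 : S n a = (K.cl (range x)).map (h m c).toHom := by
      have key : ∀ y, h m c y ∈ S n a ↔ y ∈ K.cl (range x) := by
        intro y
        rw [hS, mem_cl_iff_exists_realize hR hint hLS (hR.mem _)]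
        refine exists_congr fun q => exists_congr fun z => ?_
        rw [← hh_rel, Fin.comp_cons, hx']
      ext b
      constructor
      · intro hb
        obtain ⟨y, rfl⟩ := hsub n m a c (fun j => ⟨x j, hx j⟩) hb
        exact ⟨y, (key y).1 hb, rfl⟩
      · rintro ⟨y, hy, rfl⟩
        exact (key y).2 hy
    rw [h1]
    exact (strong_comap_map_iff _ _).2 (hint _ (hR.mem _) _)
  have hself : ∀ n (a : Fin n → N), range a ⊆ S n a := fun n a b hb =>
    (hS _ _ _).2 (A.inClosure_of_mem_range hR hint hLS hb)
  obtain ⟨l, d, hmono, hcov⟩ := exists_tuples_exhausting N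
  obtain ⟨hN, hd⟩ := mem_of_nat_chain (K := K) (S := fun k => S (l k) (d k))
    (fun k k' hkk' => by
      have h1 : ∀ j, d k j ∈ S (l k') (d k') := fun j =>
        hself _ _ (hmono hkk' (mem_range_self j))
      exact ⟨hsub _ _ _ _ h1, hstrong _ _ _ _ h1⟩)
    (fun x => (hcov x).imp fun k hk => hself _ _ hk)
  refine ⟨hN, fun n q a => ?_⟩
  -- A tuple `a` lies in some member of the chain, so that its closure is strong in `N` as well.
  choose k hk using fun j => hcov (a j)
  have h1 : ∀ j, a j ∈ S _ (d (Finset.univ.sup k)) := fun j =>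
    hself _ _ (hmono (Finset.le_sup (Finset.mem_univ j)) (hk j))
  have h2 : K.StrongEmb (h n a) := K.strong_trans _ _ (hsub _ _ _ _ h1) (hstrong _ _ _ _ h1) (hd _)
  conv_lhs => rw [← hh_tuple n a]
  rw [hh_rel, ← realize_comp_iff hint h2, hh_tuple]

end

end ClosureAxioms

end AEC

/-! ### Codes of structures -/

namespace StructureCode

open FirstOrder.Language Set FirstOrder.Language.Structure

variable {L : FirstOrder.Language.{u, u}}

/-- According to the code `c`, the number `k` is in the universe. -/
abbrev HasElem (c : StructureCode L) (k : ℕ) : Prop :=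
  c (Sum.inl k) = true

/-- According to the code `c`, the relation `r` holds at `a`. -/
abbrev HasRel (c : StructureCode L) {n : ℕ} (r : L.Relations n) (a : Fin n → ℕ) : Prop :=
  c (Sum.inr (Sum.inl ⟨n, r, a⟩)) = true

/-- According to the code `c`, the value of the function `f` at `a` is defined and equals `m`. -/
abbrev HasValue (c : StructureCode L) {n : ℕ} (f : L.Functions n) (a : Fin n → ℕ) (m : ℕ) : Prop :=
  c (Sum.inr (Sum.inr ⟨n, f, a, m⟩)) = true

theorem ext_iff_has {c d : StructureCode L} : c = d ↔ (∀ k, c.HasElem k ↔ d.HasElem k) ∧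
    (∀ (n : ℕ) (r : L.Relations n) (a : Fin n → ℕ), c.HasRel r a ↔ d.HasRel r a) ∧
    ∀ (n : ℕ) (f : L.Functions n) (a : Fin n → ℕ) (m : ℕ),
      c.HasValue f a m ↔ d.HasValue f a m := by
  refine ⟨?_, fun h => funext fun x => Bool.eq_iff_iff.2 ?_⟩
  · rintro rfl
    simp
  · rcases x with k | ⟨n, r, a⟩ | ⟨n, f, a, m⟩
    exacts [h.1 k, h.2.1 n r a, h.2.2 n f a m]

section

variable {M : Type u} [L.Structure M] (g : M ↪ ℕ) {n : ℕ}

theorem hasElem_structureCode (k : ℕ) : HasElem (L := L) (structureCode g) k ↔ ∃ x, g x = k :=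
  @decide_eq_true_iff _ (Classical.propDecidable _)

theorem hasRel_structureCode (r : L.Relations n) (a : Fin n → ℕ) :
    HasRel (structureCode g) r a ↔ ∃ b : Fin n → M, (∀ i, g (b i) = a i) ∧ RelMap r b :=
  @decide_eq_true_iff _ (Classical.propDecidable _)

theorem hasValue_structureCode (f : L.Functions n) (a : Fin n → ℕ) (m : ℕ) :
    HasValue (structureCode g) f a m ↔
      ∃ b : Fin n → M, (∀ i, g (b i) = a i) ∧ g (funMap f b) = m :=
  @decide_eq_true_iff _ (Classical.propDecidable _)

theorem comp_injective {b b' : Fin n → M} (h : ∀ i, g (b i) = g (b' i)) : b = b' :=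
  funext fun i => g.injective (h i)

theorem hasRel_structureCode_comp (r : L.Relations n) (b : Fin n → M) :
    HasRel (structureCode g) r (g ∘ b) ↔ RelMap r b := by
  rw [hasRel_structureCode]
  constructor
  · rintro ⟨b', hb', h⟩
    rwa [← comp_injective g hb']
  · exact fun h => ⟨b, fun _ => rfl, h⟩

theorem hasValue_structureCode_comp (f : L.Functions n) (b : Fin n → M) (x : M) :
    HasValue (structureCode g) f (g ∘ b) (g x) ↔ funMap f b = x := by
  rw [hasValue_structureCode]
  constructor
  · rintro ⟨b', hb', h⟩
    rw [← comp_injective g hb']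
    exact g.injective h
  · exact fun h => ⟨b, fun _ => rfl, congrArg g h⟩

theorem exists_comp_eq {a : Fin n → ℕ} (h : ∀ j, HasElem (L := L) (structureCode g) (a j)) :
    ∃ b : Fin n → M, g ∘ b = a := by
  choose b hb using fun j => (hasElem_structureCode g _).1 (h j)
  exact ⟨b, funext hb⟩

end

/-- The conditions under which a point of the space of codes is the code of a structure. -/
def IsValid (c : StructureCode L) : Prop :=
  (∀ (n : ℕ) (r : L.Relations n) (a : Fin n → ℕ), c.HasRel r a → ∀ j, c.HasElem (a j)) ∧
  (∀ (n : ℕ) (f : L.Functions n) (a : Fin n → ℕ) (m : ℕ), c.HasValue f a m →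
    (∀ j, c.HasElem (a j)) ∧ c.HasElem m) ∧
  (∀ (n : ℕ) (f : L.Functions n) (a : Fin n → ℕ) (m m' : ℕ), c.HasValue f a m →
    c.HasValue f a m' → m = m') ∧
  ∀ (n : ℕ) (f : L.Functions n) (a : Fin n → ℕ), (∀ j, c.HasElem (a j)) → ∃ m, c.HasValue f a m

theorem isValid_structureCode {M : Type u} [L.Structure M] (g : M ↪ ℕ) :
    IsValid (L := L) (structureCode g) := by
  refine ⟨fun n r a h j => ?_, fun n f a m h => ?_, fun n f a m m' h h' => ?_, fun n f a h => ?_⟩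
  · obtain ⟨b, hb, -⟩ := (hasRel_structureCode g r a).1 h
    exact (hasElem_structureCode g _).2 ⟨b j, hb j⟩
  · obtain ⟨b, hb, hm⟩ := (hasValue_structureCode g f a m).1 h
    exact ⟨fun j => (hasElem_structureCode g _).2 ⟨b j, hb j⟩,
      (hasElem_structureCode g _).2 ⟨_, hm⟩⟩
  · obtain ⟨b, hb, rfl⟩ := (hasValue_structureCode g f a m).1 h
    obtain ⟨b', hb', rfl⟩ := (hasValue_structureCode g f a m').1 h'
    rw [comp_injective g fun i => (hb i).trans (hb' i).symm]
  · obtain ⟨b, rfl⟩ := exists_comp_eq g h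
    exact ⟨_, (hasValue_structureCode_comp g f b _).2 rfl⟩

theorem IsValid.exists_eq_structureCode {c : StructureCode L} (h : c.IsValid) :
    ∃ (M : Type u) (_ : L.Structure M) (g : M ↪ ℕ), c = structureCode g := by
  obtain ⟨hrel, hval, huniq, htotal⟩ := h
  let M := ULift.{u} {k // c.HasElem k}
  let g : M ↪ ℕ := ⟨fun x => x.down.1, fun x y hxy => ULift.ext _ _ (Subtype.ext hxy)⟩
  choose F hF using htotal
  have hg : ∀ {n : ℕ} (b : Fin n → M) (j), c.HasElem ((g ∘ b) j) := fun b j => (b j).down.2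
  let _ : L.Structure M :=
    { funMap := fun {n} f b => ⟨⟨F n f (g ∘ b) (hg b), (hval _ _ _ _ (hF n f _ (hg b))).2⟩⟩
      RelMap := fun {n} r b => c.HasRel r (g ∘ b) }
  have hlift : ∀ {n : ℕ} {a : Fin n → ℕ}, (∀ j, c.HasElem (a j)) → ∃ b : Fin n → M, g ∘ b = a :=
    fun {n a} ha => ⟨fun j => ⟨⟨a j, ha j⟩⟩, rfl⟩
  refine ⟨M, inferInstance, g, ext_iff_has.2 ⟨fun k => ?_, fun n r a => ?_, fun n f a m => ?_⟩⟩
  · rw [hasElem_structureCode]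
    refine ⟨fun hk => ⟨⟨⟨k, hk⟩⟩, rfl⟩, ?_⟩
    rintro ⟨x, rfl⟩
    exact x.down.2
  · constructor
    · intro h
      obtain ⟨b, rfl⟩ := hlift (hrel _ _ _ h)
      exact (hasRel_structureCode_comp g r b).2 h
    · intro h
      obtain ⟨b, rfl⟩ := exists_comp_eq g ((isValid_structureCode g).1 _ _ _ h)
      exact (hasRel_structureCode_comp g r b).1 h
  · constructor
    · intro h
      obtain ⟨b, rfl⟩ := hlift (hval _ _ _ _ h).1
      exact (hasValue_structureCode g f _ m).2
        ⟨b, fun _ => rfl, huniq _ _ _ _ _ (hF n f _ (hg b)) h⟩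
    · intro h
      obtain ⟨b, hb, rfl⟩ := (hasValue_structureCode g f a m).1 h
      obtain rfl : g ∘ b = a := funext hb
      exact hF n f _ (hg b)

/-- The conditions under which `c` codes a substructure of the structure coded by `d`. -/
def IsSubstructureOf (c d : StructureCode L) : Prop :=
  (∀ k, c.HasElem k → d.HasElem k) ∧
  (∀ (n : ℕ) (r : L.Relations n) (a : Fin n → ℕ),
    c.HasRel r a ↔ d.HasRel r a ∧ ∀ j, c.HasElem (a j)) ∧
  ∀ (n : ℕ) (f : L.Functions n) (a : Fin n → ℕ) (m : ℕ),
    (c.HasValue f a m ↔ d.HasValue f a m ∧ ∀ j, c.HasElem (a j)) ∧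
      (c.HasValue f a m → c.HasElem m)

section

variable {N : Type u} [L.Structure N] (g : N ↪ ℕ)

theorem hasElem_structureCode_substructure (S : L.Substructure N) (x : N) :
    HasElem (L := L) (structureCode (S.subtype.toEmbedding.trans g)) (g x) ↔ x ∈ S := by
  rw [hasElem_structureCode]
  constructor
  · rintro ⟨y, hy⟩
    have : (y : N) = x := g.injective hy
    exact this ▸ y.2
  · exact fun hx => ⟨⟨x, hx⟩, rfl⟩

theorem isSubstructureOf_structureCode_iff (c : StructureCode L) :
    c.IsSubstructureOf (structureCode g) ↔
      ∃ S : L.Substructure N, c = structureCode (S.subtype.toEmbedding.trans g) := by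
  constructor
  · rintro ⟨helem, hrel, hval⟩
    let S : L.Substructure N :=
      { carrier := {x | c.HasElem (g x)}
        fun_mem := fun {n} f b hb => by
          have h1 := hval n f (g ∘ b) (g (funMap f b))
          exact h1.2 (h1.1.2 ⟨(hasValue_structureCode_comp g f b _).2 rfl, hb⟩) }
    refine ⟨S, ext_iff_has.2 ⟨fun k => ?_, fun n r a => ?_, fun n f a m => ?_⟩⟩
    · constructor
      · intro h
        obtain ⟨x, rfl⟩ := (hasElem_structureCode g k).1 (helem k h)
        exact (hasElem_structureCode_substructure g S x).2 h
      · rw [hasElem_structureCode]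
        rintro ⟨x, rfl⟩
        exact x.2
    · rw [hrel, hasRel_structureCode, hasRel_structureCode]
      constructor
      · rintro ⟨⟨b, hb, h⟩, ha⟩
        exact ⟨fun j => ⟨b j, (congrArg c.HasElem (hb j)).mpr (ha j)⟩, hb, h⟩
      · rintro ⟨b, hb, h⟩
        exact ⟨⟨fun j => b j, hb, h⟩, fun j => (congrArg c.HasElem (hb j)).mp (b j).2⟩
    · rw [(hval n f a m).1, hasValue_structureCode, hasValue_structureCode]
      constructor
      · rintro ⟨⟨b, hb, h⟩, ha⟩
        exact ⟨fun j => ⟨b j, (congrArg c.HasElem (hb j)).mpr (ha j)⟩, hb, h⟩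
      · rintro ⟨b, hb, h⟩
        exact ⟨⟨fun j => b j, hb, h⟩, fun j => (congrArg c.HasElem (hb j)).mp (b j).2⟩
  · rintro ⟨S, rfl⟩
    have hlift : ∀ {n : ℕ} {b : Fin n → N} {a : Fin n → ℕ}, (∀ j, g (b j) = a j) →
        (∀ j, HasElem (L := L) (structureCode (S.subtype.toEmbedding.trans g)) (a j)) →
        ∀ j, b j ∈ S := fun {n b a} hb ha j =>
      (hasElem_structureCode_substructure g S _).1 (by rw [hb]; exact ha j)
    refine ⟨fun k => ?_, fun n r a => ?_, fun n f a m => ⟨?_, ?_⟩⟩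
    · rw [hasElem_structureCode, hasElem_structureCode]
      rintro ⟨x, hx⟩
      exact ⟨x, hx⟩
    · constructor
      · intro h
        refine ⟨?_, (isValid_structureCode _).1 _ _ _ h⟩
        obtain ⟨b, hb, h⟩ := (hasRel_structureCode _ r a).1 h
        exact (hasRel_structureCode g r a).2 ⟨fun j => b j, hb, h⟩
      · rintro ⟨h, ha⟩
        obtain ⟨b, hb, h⟩ := (hasRel_structureCode g r a).1 h
        exact (hasRel_structureCode _ r a).2 ⟨fun j => ⟨b j, hlift hb ha j⟩, hb, h⟩
    · constructor
      · intro h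
        refine ⟨?_, ((isValid_structureCode _).2.1 _ _ _ _ h).1⟩
        obtain ⟨b, hb, h⟩ := (hasValue_structureCode _ f a m).1 h
        exact (hasValue_structureCode g f a m).2 ⟨fun j => b j, hb, h⟩
      · rintro ⟨h, ha⟩
        obtain ⟨b, hb, h⟩ := (hasValue_structureCode g f a m).1 h
        exact (hasValue_structureCode _ f a m).2 ⟨fun j => ⟨b j, hlift hb ha j⟩, hb, h⟩
    · exact fun h => ((isValid_structureCode _).2.1 _ _ _ _ h).2

end

/-- The code of the reduct of a coded structure. -/
def reduct {L' : FirstOrder.Language.{u, u}} (φ : L →ᴸ L') (c : StructureCode L') :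
    StructureCode L
  | Sum.inl k => c (Sum.inl k)
  | Sum.inr (Sum.inl ⟨n, r, a⟩) => c (Sum.inr (Sum.inl ⟨n, φ.onRelation r, a⟩))
  | Sum.inr (Sum.inr ⟨n, f, a, m⟩) => c (Sum.inr (Sum.inr ⟨n, φ.onFunction f, a, m⟩))

theorem continuous_reduct {L' : FirstOrder.Language.{u, u}} (φ : L →ᴸ L') :
    Continuous (reduct φ) := by
  refine continuous_pi fun x => ?_
  rcases x with k | ⟨n, r, a⟩ | ⟨n, f, a, m⟩ <;> exact continuous_apply _

theorem reduct_structureCode {L' : FirstOrder.Language.{u, u}} (φ : L →ᴸ L') {M : Type u}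
    [L.Structure M] [L'.Structure M] [φ.IsExpansionOn M] (g : M ↪ ℕ) :
    reduct φ (structureCode g) = structureCode g := by
  refine ext_iff_has.2 ⟨fun k => Iff.rfl, fun n r a => ?_, fun n f a m => ?_⟩
  · rw [hasRel_structureCode]
    refine (hasRel_structureCode g (φ.onRelation r) a).trans ?_
    simp only [LHom.map_onRelation]
  · rw [hasValue_structureCode]
    refine (hasValue_structureCode g (φ.onFunction f) a m).trans ?_
    simp only [LHom.map_onFunction]

/-! ### Topology and measurability of the space of codes -/

theorem polishSpace [∀ n, Countable (L.Relations n)] [∀ n, Countable (L.Functions n)] :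
    PolishSpace (StructureCode L) where

section

variable {Z : Type*} [TopologicalSpace Z] [MeasurableSpace Z] [BorelSpace Z]

theorem measurable_apply_eq_true {c : Z → StructureCode L} (hc : Continuous c)
    (x : AtomicFact L) : Measurable fun z => c z x = true := by
  refine measurableSet_setOfPred.1 (IsOpen.measurableSet ?_)
  exact (isOpen_discrete {true}).preimage ((continuous_apply x).comp hc)

variable [hrel : ∀ n, Countable (L.Relations n)] [hfun : ∀ n, Countable (L.Functions n)]

theorem measurable_isValid {c : Z → StructureCode L} (hc : Continuous c) :
    Measurable fun z => (c z).IsValid := by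
  have h := measurable_apply_eq_true hc
  refine .and ?_ (.and ?_ (.and ?_ ?_))
  · exact .forall fun n => .forall fun r => .forall fun a => (h _).imp (.forall fun j => h _)
  · exact .forall fun n => .forall fun f => .forall fun a => .forall fun m =>
      (h _).imp (.and (.forall fun j => h _) (h _))
  · exact .forall fun n => .forall fun f => .forall fun a => .forall fun m => .forall fun m' =>
      (h _).imp ((h _).imp measurable_const)
  · exact .forall fun n => .forall fun f => .forall fun a =>
      .imp (.forall fun j => h _) (.exists fun m => h _)

theorem measurable_isSubstructureOf {c d : Z → StructureCode L} (hc : Continuous c)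
    (hd : Continuous d) : Measurable fun z => (c z).IsSubstructureOf (d z) := by
  have h := measurable_apply_eq_true hc
  have h' := measurable_apply_eq_true hd
  refine .and ?_ (.and ?_ ?_)
  · exact .forall fun k => (h _).imp (h' _)
  · exact .forall fun n => .forall fun r => .forall fun a =>
      (h _).iff (.and (h' _) (.forall fun j => h _))
  · exact .forall fun n => .forall fun f => .forall fun a => .forall fun m =>
      .and ((h _).iff (.and (h' _) (.forall fun j => h _))) ((h _).imp (h _))

end

end StructureCode

namespace AEC

open FirstOrder.Language Set FirstOrder.Language.Structure

variable {L : FirstOrder.Language.{u, u}} {K : AEC L} {ι : Type u}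
  {R : ι → CategoryTheory.Bundled.{u} L.Structure}

/-! ### The functorial expansion is Borel presented -/

/-- The translation of `ClosureAxioms` to codes.  A hypothesis that a tuple of numbers consists of
elements of the universe is needed only in the first axiom: a valid code makes a predicate true
only at such tuples. -/
def ClosureAxiomsCode (K : AEC L) (R : ι → CategoryTheory.Bundled.{u} L.Structure)
    (c : StructureCode (K.expandedLanguage R)) : Prop :=
  (∀ (n : ℕ) (a : Fin n → ℕ), (∀ j, c.HasElem (a j)) →
    ∃ p : K.ClosureType R n, c.HasRel p.symbol a) ∧
  ∀ (n : ℕ) (a : Fin n → ℕ) (p : K.ClosureType R n), c.HasRel p.symbol a →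
    (∀ j k, a j = a k ↔ p.tuple j = p.tuple k) ∧
    (∀ (m : ℕ) (r : L.Relations m) (σ : Fin m → Fin n),
      c.HasRel ((K.expansion R).onRelation r) (a ∘ σ) ↔ RelMap r (p.tuple ∘ σ)) ∧
    (∀ (m : ℕ) (f : L.Functions m) (σ : Fin m → Fin n) (k : Fin n),
      c.HasValue ((K.expansion R).onFunction f) (a ∘ σ) (a k) ↔
        funMap f (p.tuple ∘ σ) = p.tuple k) ∧
    (∀ (m : ℕ) (q : K.ClosureType R m) (σ : Fin m → Fin n),
      c.HasRel q.symbol (a ∘ σ) ↔ q.Realize (p.tuple ∘ σ)) ∧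
    ∀ y : R p.index, ∃ b : ℕ, c.HasRel (p.cons y).symbol (Fin.cons b a : Fin (n + 1) → ℕ)

open StructureCode in
theorem closureAxiomsCode_structureCode {N : Type u} [(K.expandedLanguage R).Structure N]
    (g : N ↪ ℕ) : ClosureAxiomsCode K R (structureCode g) ↔ ClosureAxioms K R N := by
  constructor
  · rintro ⟨h1, h2⟩
    have h3 := fun (n : ℕ) (a : Fin n → N) (p : K.ClosureType R n) (hp : RelMap p.symbol a) =>
      h2 n (g ∘ a) p ((hasRel_structureCode_comp g p.symbol a).2 hp)
    refine ⟨fun n a => ?_, fun n a p hp j k => ?_, fun n a p hp m r σ => ?_,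
      fun n a p hp m f σ k => ?_, fun n a p hp m q σ => ?_, fun n a p hp y => ?_⟩
    · obtain ⟨p, hp⟩ := h1 n (g ∘ a) fun j => (hasElem_structureCode g _).2 ⟨a j, rfl⟩
      exact ⟨p, (hasRel_structureCode_comp g p.symbol a).1 hp⟩
    · exact g.injective.eq_iff.symm.trans ((h3 n a p hp).1 j k)
    · exact (hasRel_structureCode_comp g _ _).symm.trans ((h3 n a p hp).2.1 m r σ)
    · exact (hasValue_structureCode_comp g _ _ _).symm.trans ((h3 n a p hp).2.2.1 m f σ k)
    · exact (hasRel_structureCode_comp g _ _).symm.trans ((h3 n a p hp).2.2.2.1 m q σ)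
    · obtain ⟨b, hb⟩ := (h3 n a p hp).2.2.2.2 y
      obtain ⟨x, rfl⟩ := (hasElem_structureCode g _).1 ((isValid_structureCode g).1 _ _ _ hb 0)
      refine ⟨x, (hasRel_structureCode_comp g _ _).1 ?_⟩
      rwa [Fin.comp_cons]
  · intro A
    refine ⟨fun n a ha => ?_, fun n a p hp => ?_⟩
    · obtain ⟨b, rfl⟩ := exists_comp_eq g ha
      exact (A.exists_type n b).imp fun p hp => (hasRel_structureCode_comp g p.symbol b).2 hp
    · obtain ⟨b, rfl⟩ := exists_comp_eq g ((isValid_structureCode g).1 _ _ _ hp)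
      rw [hasRel_structureCode_comp] at hp
      refine ⟨fun j k => ?_, fun m r σ => ?_, fun m f σ k => ?_, fun m q σ => ?_, fun y => ?_⟩
      · exact g.injective.eq_iff.trans (A.eq_iff n b p hp j k)
      · exact (hasRel_structureCode_comp g _ _).trans (A.rel_iff n b p hp m r σ)
      · exact (hasValue_structureCode_comp g _ _ _).trans (A.fun_iff n b p hp m f σ k)
      · exact (hasRel_structureCode_comp g _ _).trans (A.type_iff n b p hp m q σ)
      · obtain ⟨x, hx⟩ := A.extend n b p hp y
        refine ⟨g x, ?_⟩
        rw [← Fin.comp_cons]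
        exact (hasRel_structureCode_comp g _ _).2 hx

/-- According to the codes, every element of `d` in the closure of a tuple from `c` is in `c`. -/
def ClosedCode (K : AEC L) (R : ι → CategoryTheory.Bundled.{u} L.Structure)
    (c d : StructureCode (K.expandedLanguage R)) : Prop :=
  ∀ (n : ℕ) (a : Fin n → ℕ) (p : K.ClosureType R n) (y : R p.index) (b : ℕ),
    d.HasRel (p.cons y).symbol (Fin.cons b a : Fin (n + 1) → ℕ) → (∀ j, c.HasElem (a j)) →
      c.HasElem b

open StructureCode in
theorem closedCode_structureCode {N : Type u} [(K.expandedLanguage R).Structure N]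
    (g : N ↪ ℕ) (S : (K.expandedLanguage R).Substructure N) :
    ClosedCode K R (structureCode (S.subtype.toEmbedding.trans g)) (structureCode g) ↔
      ∀ (n : ℕ) (a : Fin n → N), (∀ j, a j ∈ S) → ∀ b, InClosure K R a b → b ∈ S := by
  constructor
  · rintro h n a ha b ⟨p, y, hb⟩
    refine (hasElem_structureCode_substructure g S b).1 (h n (g ∘ a) p y (g b) ?_ fun j =>
      (hasElem_structureCode_substructure g S _).2 (ha j))
    rw [← Fin.comp_cons]
    exact (hasRel_structureCode_comp g _ _).2 hb
  · intro h n a p y b hb ha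
    obtain ⟨b', hb'⟩ := exists_comp_eq g ((isValid_structureCode g).1 _ _ _ hb)
    have hb₀ : g (b' 0) = b := congrFun hb' 0
    have ha₀ : ∀ j, g (b' j.succ) = a j := fun j => congrFun hb' j.succ
    rw [← hb₀, hasElem_structureCode_substructure]
    refine h n (fun j => b' j.succ) (fun j => ?_) (b' 0) ⟨p, y, ?_⟩
    · rw [← hasElem_structureCode_substructure g, ha₀]
      exact ha j
    · rw [← hb', hasRel_structureCode_comp] at hb
      convert hb
      exact Fin.cons_self_tail b'

section

variable (hR : K.Representatives R) (hint : K.HasIntersections)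
  (hcard : (K.expandedLanguage R).card ≤ ℵ₀) (hLS : K.LS = ℵ₀)

include hR

theorem codes_expandedAEC : (expandedAEC K R hint hcard hLS).codes =
    {c | c.IsValid ∧ ClosureAxiomsCode K R c} := by
  ext c
  constructor
  · rintro ⟨N, _, g, hN, rfl⟩
    let _ := (K.expansion R).reduct N
    exact ⟨StructureCode.isValid_structureCode g, (closureAxiomsCode_structureCode g).2
      (IsCanonical.closureAxioms hR hint hLS hN.1 hN.2)⟩
  · rintro ⟨hc, hA⟩
    obtain ⟨N, _, g, rfl⟩ := hc.exists_eq_structureCode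
    have : Countable N := g.injective.countable
    let _ := (K.expansion R).reduct N
    exact ⟨N, _, g, ((closureAxiomsCode_structureCode g).1 hA).mem_and_isCanonical hR hint hLS, rfl⟩

theorem strongCodes_expandedAEC : (expandedAEC K R hint hcard hLS).strongCodes =
    {p | (p.2.IsValid ∧ ClosureAxiomsCode K R p.2) ∧ p.1.IsSubstructureOf p.2 ∧
      ClosedCode K R p.1 p.2} := by
  have hcodes := codes_expandedAEC hR hint hcard hLS
  ext ⟨c, d⟩
  constructor
  · rintro ⟨N, _, g, S, hS, h⟩
    obtain ⟨rfl, rfl⟩ := Prod.mk.inj h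
    let _ := (K.expansion R).reduct N
    refine ⟨hcodes.subset ⟨N, _, g, hS.mem_right, rfl⟩,
      (StructureCode.isSubstructureOf_structureCode_iff g _).2 ⟨S, rfl⟩,
      (closedCode_structureCode g S).2 fun n a ha b hb => ?_⟩
    have h1 := (hS.1.inClosure_iff hR hint hLS (K.mem_of_strong _ hS.2).2 a b).1 hb
    exact cl_le hS.2 (range_subset_iff.2 ha) h1
  · rintro ⟨h1, h2, h3⟩
    obtain ⟨N, _, g, hN, rfl⟩ := hcodes.superset h1
    obtain ⟨S, rfl⟩ := (StructureCode.isSubstructureOf_structureCode_iff g _).1 h2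
    rw [closedCode_structureCode] at h3
    have : Countable N := g.injective.countable
    let _ := (K.expansion R).reduct N
    refine ⟨N, _, g, S, ⟨hN.2, ?_⟩, rfl⟩
    have : Countable ((K.expansion R).substructureReduct S) := inferInstanceAs (Countable S)
    refine strong_of_cl_le hint hN.1 _ fun n a ha b hb => h3 n a ha b ?_
    exact (hN.2.inClosure_iff hR hint hLS hN.1 a b).2 hb

theorem measurable_closureAxiomsCode [Countable ι] {Z : Type*} [TopologicalSpace Z]
    [MeasurableSpace Z] [BorelSpace Z] [∀ n, Countable (L.Relations n)]
    [∀ n, Countable (L.Functions n)] {c : Z → StructureCode (K.expandedLanguage R)}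
    (hc : Continuous c) : Measurable fun z => ClosureAxiomsCode K R (c z) := by
  have := hR.countable
  have := countable_closureType K R hR
  have h := StructureCode.measurable_apply_eq_true hc
  refine .and ?_ (.forall fun n => .forall fun a => .forall fun p =>
    .imp (h _) (.and ?_ (.and ?_ (.and ?_ (.and ?_ ?_)))))
  · exact .forall fun n => .forall fun a => .imp (.forall fun j => h _) (.exists fun p => h _)
  · exact measurable_const
  · exact .forall fun m => .forall fun r => .forall fun σ => (h _).iff measurable_const
  · exact .forall fun m => .forall fun f => .forall fun σ => .forall fun k =>
      (h _).iff measurable_const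
  · exact .forall fun m => .forall fun q => .forall fun σ => (h _).iff measurable_const
  · exact .forall fun y => .exists fun b => h _

theorem measurable_closedCode [Countable ι] {Z : Type*} [TopologicalSpace Z]
    [MeasurableSpace Z] [BorelSpace Z] {c d : Z → StructureCode (K.expandedLanguage R)}
    (hc : Continuous c) (hd : Continuous d) : Measurable fun z => ClosedCode K R (c z) (d z) := by
  have := hR.countable
  have := countable_closureType K R hR
  have h := StructureCode.measurable_apply_eq_true hc
  have h' := StructureCode.measurable_apply_eq_true hd
  exact .forall fun n => .forall fun a => .forall fun p => .forall fun y => .forall fun b =>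
    (h' _).imp (.imp (.forall fun j => h _) (h _))

theorem borelPresented_expandedAEC [Countable ι] :
    (expandedAEC K R hint hcard hLS).BorelPresented := by
  obtain ⟨hrel, hfun⟩ := countable_symbols (card_le_aleph0 hLS)
  obtain ⟨hrel', hfun'⟩ := countable_symbols hcard
  refine ⟨LS_expandedAEC hint hcard hLS, ?_, ?_⟩
  · rw [codes_expandedAEC hR]
    let _ : MeasurableSpace (StructureCode (K.expandedLanguage R)) := borel _
    have : BorelSpace (StructureCode (K.expandedLanguage R)) := ⟨rfl⟩
    exact measurableSet_setOfPred.2 <| .and (StructureCode.measurable_isValid continuous_id)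
      (measurable_closureAxiomsCode hR continuous_id)
  · rw [strongCodes_expandedAEC hR]
    let _ : MeasurableSpace
      (StructureCode (K.expandedLanguage R) × StructureCode (K.expandedLanguage R)) := borel _
    have : BorelSpace
      (StructureCode (K.expandedLanguage R) × StructureCode (K.expandedLanguage R)) := ⟨rfl⟩
    exact measurableSet_setOfPred.2 <| .and
      (.and (StructureCode.measurable_isValid continuous_snd)
        (measurable_closureAxiomsCode hR continuous_snd))
      (.and (StructureCode.measurable_isSubstructureOf continuous_fst continuous_snd)
        (measurable_closedCode hR continuous_fst continuous_snd))

end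

/-! ### Reducts of Borel presented classes -/

namespace IsFunctorialExpansion

variable {L' : FirstOrder.Language.{u, u}} {φ : L →ᴸ L'} {K' : AEC L'}

theorem codes_eq_image (h : K.IsFunctorialExpansion φ K') :
    K.codes = StructureCode.reduct φ '' K'.codes := by
  ext c
  constructor
  · rintro ⟨M, _, g, hM, rfl⟩
    obtain ⟨s, ⟨_, hs⟩, -⟩ := h.existsUnique M hM
    exact ⟨_, ⟨M, s, g, hs, rfl⟩, StructureCode.reduct_structureCode φ g⟩
  · rintro ⟨_, ⟨M, _, g, hM, rfl⟩, rfl⟩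
    let _ := φ.reduct M
    exact ⟨M, _, g, h.reduct_mem M hM, StructureCode.reduct_structureCode φ g⟩

theorem strongCodes_eq_image (h : K.IsFunctorialExpansion φ K') :
    K.strongCodes =
      Prod.map (StructureCode.reduct φ) (StructureCode.reduct φ) '' K'.strongCodes := by
  have key : ∀ (N : Type u) [L.Structure N] [L'.Structure N] [φ.IsExpansionOn N] (g : N ↪ ℕ)
      (S' : L'.Substructure N), StructureCode.reduct φ (structureCode
        (S'.subtype.toEmbedding.trans g)) =
      structureCode ((φ.substructureReduct S').subtype.toEmbedding.trans g) := by
    intro N _ _ _ g S'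
    obtain rfl := eq_reduct φ (N := N)
    let _ := φ.reduct S'
    exact StructureCode.reduct_structureCode φ (S'.subtype.toEmbedding.trans g)
  ext c
  constructor
  · rintro ⟨N, _, g, S, hS, rfl⟩
    obtain ⟨s, ⟨_, hs⟩, -⟩ := h.existsUnique N (K.mem_of_strong _ hS).2
    obtain ⟨S', hS', hmem⟩ := h.mono N hs S hS
    obtain rfl : φ.substructureReduct S' = S := SetLike.coe_injective hS'
    refine ⟨_, ⟨N, s, g, S', (h.strong_iff N S').2 ⟨hmem, hs, hS⟩, rfl⟩, ?_⟩
    exact Prod.ext (key N g S') (StructureCode.reduct_structureCode φ g)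
  · rintro ⟨_, ⟨N, _, g, S', hS', rfl⟩, rfl⟩
    let _ := φ.reduct N
    refine ⟨N, _, g, φ.substructureReduct S', ((h.strong_iff N S').1 hS').2.2, ?_⟩
    exact Prod.ext (key N g S') (StructureCode.reduct_structureCode φ g)

/-- A class with a Borel presented functorial expansion is analytically presented, since the codes
of its members are the reducts of those of the expansion. -/
theorem analyticallyPresented (h : K.IsFunctorialExpansion φ K') (hLS : K.LS = ℵ₀)
    (hK' : K'.BorelPresented) : K.AnalyticallyPresented := by
  obtain ⟨hrel, hfun⟩ := countable_symbols (card_le_aleph0 hK'.1)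
  have := StructureCode.polishSpace (L := L')
  refine ⟨hLS, ?_, ?_⟩
  · rw [h.codes_eq_image]
    let _ : MeasurableSpace (StructureCode L') := borel _
    have : BorelSpace (StructureCode L') := ⟨rfl⟩
    exact hK'.2.1.analyticSet.image_of_continuous (StructureCode.continuous_reduct φ)
  · rw [h.strongCodes_eq_image]
    let _ : MeasurableSpace (StructureCode L' × StructureCode L') := borel _
    have : BorelSpace (StructureCode L' × StructureCode L') := ⟨rfl⟩
    exact hK'.2.2.analyticSet.image_of_continuous
      ((StructureCode.continuous_reduct φ).prodMap (StructureCode.continuous_reduct φ))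

end IsFunctorialExpansion

end AEC

theorem corollary3p12 (L : FirstOrder.Language.{u, u}) (K : AEC L)
    (hint : K.HasIntersections) (hLS : K.LS = Cardinal.aleph0)
    (hcount : K.countableModels.Countable) :
    (∃ (L' : FirstOrder.Language.{u, u}) (φ : FirstOrder.Language.LHom L L') (K' : AEC L'),
      K.IsFunctorialExpansion φ K' ∧ K'.BorelPresented) ∧
    K.AnalyticallyPresented := by
  obtain ⟨ι, _, R, hR⟩ := K.exists_representatives hcount
  have hcard := AEC.card_expandedLanguage hR (AEC.card_le_aleph0 hLS)
  have hexp := AEC.isFunctorialExpansion_expandedAEC hint hcard hLS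
  have hborel := AEC.borelPresented_expandedAEC hR hint hcard hLS
  exact ⟨⟨_, _, _, hexp, hborel⟩, hexp.analyticallyPresented hLS hborel⟩
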